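/- **Model.** A network has a source $S$, relays $R1,R2$ and a destination $D$. Let $M_{R1},\lambda_1,W_{SR2},W_{R1R2}>0$, $M_{R2}\in\mathbb R$, $R_0\ge 0$ and $\Gamma_{th}=2^{R_0}-1$. In every time slot $i=0,1,2,\dots$ there are random variables: the transmitter candidate set $TC(i)$, which is $\{S\}$, $\{S,R1\}$, $\{S,R2\}$ or one of three variants of $\{S,R1,R2\}$; real SNRs $\gamma_{SD}(i),\gamma_{R1D}(i),\gamma_{R2D}(i),\gamma_{SR2}(i),\gamma_{R1R2}(i)$ of the links and accumulated SNRs $\gamma_{overall1}(i),\gamma_{overall3}(i)$; the energy $X(i)$ harvested by $R1$; and the energies $B_1(i),B_2(i)$ stored by $R1$ and $R2$. Here $X(i)$, $\gamma_{SR2}(i)$, $\gamma_{R1R2}(i)$ are exponential with rates $\lambda_1$, $W_{SR2}$, $W_{R1R2}$, and $B_1(0)\ge 0$ almost surely. Put $$C_i=\{\gamma_{overall1}+\gamma_{SD}<\Gamma_{th}\},\quad D_i=\{\gamma_{overall1}+\gamma_{R1D}<\Gamma_{th}\},\quad U_i=\{B_2\ge M_{R2}\},$$ $$O_i=\{\gamma_{overall3}+\gamma_{SD}<\Gamma_{th}\},\quad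 F_i=\{\gamma_{overall3}+\gamma_{R2D}<\Gamma_{th}\},\quad G_i=\{\gamma_{overall3}+\gamma_{R1D}<\Gamma_{th}\}$$ (all at slot $i$), and assume that their probabilities $\mathfrak c,\mathfrak d,PU_2,\mathfrak o,\mathfrak f,\mathfrak g$, as well as $p_{SR1}=\Pr\{TC(i)=\{S,R1\}\}$ and the probabilities $p_1,p_2,p_3$ of the three variants of $\{S,R1,R2\}$, do not depend on $i$. Assume that for each $i$ the family $B_1(i),X(i),TC(i),\mathbf 1_{C_i},\mathbf 1_{D_i},\gamma_{SR2}(i),\gamma_{R1R2}(i)$ is mutually independent, and so is the family $B_1(i),X(i),TC(i),\mathbf 1_{O_i},\mathbf 1_{F_i},\mathbf 1_{G_i},\mathbf 1_{U_i}$. A transmission by $R1$ is *called for* in slot $i$ if one of the following holds: * $TC(i)=\{S,R1\}$ and $C_i\cap \overline{D_i}$; * $TC(i)=\{S,R1\}$, $C_i\cap D_i$, $\gamma_{SR2}(i)<\Gamma_{th}$ and $\gamma_{R1R2}(i)\ge\Gamma_{th}$; * $TC(i)=\{S,R1,R2\}$ (any variant) and $U_i\cap O_i\cap F_i\cap\overline{G_i}$;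 * $TC(i)=\{S,R1,R2\}$ (any variant) and $\overline{U_i}\cap O_i\cap\overline{G_i}$. Almost surely, $B_1(i+1)=B_1(i)-M_{R1}+X(i)$ if a transmission is called for and $B_1(i)\ge M_{R1}$, and $B_1(i+1)=B_1(i)+X(i)$ otherwise. Let $$b_1=p_{SR1}\,\mathfrak c\big[(1-\mathfrak d)+\mathfrak d(1-e^{-W_{SR2}\Gamma_{th}})e^{-W_{R1R2}\Gamma_{th}}\big]+PU_2\,(p_1+p_2+p_3)\,\mathfrak o\,\mathfrak f\,(1-\mathfrak g)+(1-PU_2)(p_1+p_2+p_3)\,\mathfrak o\,(1-\mathfrak g)$$ and $\psi_{R1}=\lambda_1M_{R1}b_1$. **Theorem.** Suppose $\psi_{R1}>1$. Then in every slot a transmission by $R1$ is called for with probability $b_1$. Let $W$ be the principal branch of the real Lambert function ($W(y)\ge -1$ and $W(y)e^{W(y)}=y$ for $y\ge -1/e$) and $$Q_1=\frac{-W\!\left(-b_1\lambda_1M_{R1}e^{-b_1\lambda_1M_{R1}}\right)}{M_{R1}}-b_1\lambda_1 .$$ Then $Q_1<0$ and $b_1\lambda_1e^{Q_1M_{R1}}=b_1\lambda_1+Q_1$.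 The function $$g_1(x)=\begin{cases}\dfrac{1}{M_{R1}}\left(1-e^{Q_1x}\right),&0\le x<M_{R1},\\[2mm]\dfrac1{M_{R1}}\dfrac{-Q_1e^{Q_1x}}{b_1\lambda_1+Q_1},&x\ge M_{R1},\end{cases}$$ and $g_1(x)=0$ for $x<0$, is a probability density. The law $\pi$ with density $g_1$ is the unique stationary distribution on $[0,\infty)$ of the energy update (discharge called for with probability $b_1$, harvest exponential with rate $\lambda_1$, both independent of the current level); in particular, if $B_1(0)$ has law $\pi$, then so has every $B_1(i)$. Whatever the law of $B_1(0)$ on $[0,\infty)$, the law of $B_1(i)$ converges to $\pi$ in total variation as $i\to\infty$. Finally $\pi([M_{R1},\infty))=\dfrac{1}{b_1\lambda_1M_{R1}}$ and $\Pr\{B_1(i)\ge M_{R1}\}\to\dfrac{1}{b_1\lambda_1M_{R1}}$. -/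

import Mathlib

open MeasureTheory ProbabilityTheory

namespace EHRelay

noncomputable section

/-- The principal branch of the real Lambert `W` function: for `y ≥ -1/e`, the number `w ≥ -1`
with `w * exp w = y`. -/
def lambertW (y : ℝ) : ℝ :=
  Function.invFunOn (fun w : ℝ => w * Real.exp w) (Set.Ici (-1)) y

/-- The possible transmitter candidate sets: `{S}`, `{S,R1}`, `{S,R2}`, and the three variants
of `{S,R1,R2}`. -/
inductive TC : Type
  | s | sr1 | sr2 | all1 | all2 | all3

instance : MeasurableSpace TC := ⊤

/-- All three transmitters hold the packet. -/
def TC.IsAll (t : TC) : Prop := t = TC.all1 ∨ t = TC.all2 ∨ t = TC.all3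

/-- The numerical parameters on which the energy buffer of R1 depends. -/
structure Params where
  /-- energy `M_{R1}`, `M_{R2}` spent by R1, R2 for one transmission -/
  M1 : ℝ
  M2 : ℝ
  /-- rate of the exponentially distributed energy harvested by R1 in one slot -/
  lam1 : ℝ
  /-- target data rate -/
  R0 : ℝ
  /-- rates of the exponentially distributed SNRs of the links S-R2 and R1-R2 -/
  WSR2 : ℝ
  WR1R2 : ℝ
  /-- probabilities of the transmitter candidate sets `{S,R1}` and `{S,R1,R2}` (three variants) -/
  pSR1 : ℝ
  p1 : ℝ
  p2 : ℝ
  p3 : ℝ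
  /-- probabilities of the transmission failures C, D, O, F, G (see `Network`) -/
  c : ℝ
  d : ℝ
  o : ℝ
  f : ℝ
  g : ℝ
  /-- probability that R2 holds enough energy to transmit -/
  PU2 : ℝ

namespace Params

variable (θ : Params)

/-- SNR threshold `Γ_th = 2 ^ R₀ - 1`. -/
def Gth : ℝ := (2 : ℝ) ^ θ.R0 - 1

/-- The discharge probability `b₁` of R1. -/
def b1 : ℝ :=
  θ.pSR1 * θ.c *
      ((1 - θ.d) + θ.d * (1 - Real.exp (-θ.WSR2 * θ.Gth)) * Real.exp (-θ.WR1R2 * θ.Gth))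
    + θ.PU2 * ((θ.p1 + θ.p2 + θ.p3) * θ.o * θ.f * (1 - θ.g))
    + (1 - θ.PU2) * ((θ.p1 + θ.p2 + θ.p3) * θ.o * (1 - θ.g))

/-- The convergence parameter `ψ_{R1} = λ₁ M_{R1} b₁`. -/
def psi1 : ℝ := θ.lam1 * θ.M1 * θ.b1

/-- The exponent `Q₁`. -/
def Q1 : ℝ :=
  -lambertW (-(θ.b1 * θ.lam1 * θ.M1) * Real.exp (-(θ.b1 * θ.lam1 * θ.M1))) / θ.M1
    - θ.b1 * θ.lam1

/-- The limiting probability density `g₁`, which vanishes on the negative axis. -/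
def g1 (x : ℝ) : ℝ :=
  if x < 0 then 0
  else if x < θ.M1 then 1 / θ.M1 * (1 - Real.exp (θ.Q1 * x))
  else 1 / θ.M1 * (-θ.Q1 * Real.exp (θ.Q1 * x) / (θ.b1 * θ.lam1 + θ.Q1))

/-- The measure on `ℝ` with density `g₁`. -/
def limitLaw : Measure ℝ := volume.withDensity (fun x => ENNReal.ofReal (θ.g1 x))

open Classical in
/-- One step of the energy update: from level `x`, with harvested energy `e`; the amount `M_{R1}`
is spent exactly if the transmission is called for and the level suffices. -/
def step (x : ℝ) (called : Prop) (e : ℝ) : ℝ :=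
  if called ∧ θ.M1 ≤ x then x - θ.M1 + e else x + e

/-- The law of the next energy level, if the current one has law `ν` and, independently, a
transmission is called for with probability `b₁` and the harvested energy is exponential with
rate `λ₁`. -/
def nextLaw (ν : Measure ℝ) : Measure ℝ :=
  ENNReal.ofReal θ.b1 •
      (ν.prod (expMeasure θ.lam1)).map (fun q : ℝ × ℝ => θ.step q.1 True q.2)
    + ENNReal.ofReal (1 - θ.b1) •
      (ν.prod (expMeasure θ.lam1)).map (fun q : ℝ × ℝ => θ.step q.1 False q.2)

/-- `ν` is a stationary distribution of the energy update of R1. -/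
def IsStationary (ν : Measure ℝ) : Prop :=
  IsProbabilityMeasure ν ∧ ν (Set.Iio 0) = 0 ∧ θ.nextLaw ν = ν

end Params

/-- The random quantities of the network, slot by slot, on a sample space `Ω`. -/
structure Network (Ω : Type*) where
  /-- transmitter candidate set -/
  tc : ℕ → Ω → TC
  /-- SNR already accumulated at D when the candidates are `{S,R1}`, resp. `{S,R1,R2}` -/
  snrOverall1 : ℕ → Ω → ℝ
  snrOverall3 : ℕ → Ω → ℝ
  /-- SNRs of the links in the current slot -/
  snrSD : ℕ → Ω → ℝ
  snrR1D : ℕ → Ω → ℝ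
  snrR2D : ℕ → Ω → ℝ
  snrSR2 : ℕ → Ω → ℝ
  snrR1R2 : ℕ → Ω → ℝ
  /-- energy harvested by R1 -/
  X : ℕ → Ω → ℝ
  /-- energy stored by R1 and by R2 -/
  B1 : ℕ → Ω → ℝ
  B2 : ℕ → Ω → ℝ

namespace Network

variable {Ω : Type*} (N : Network Ω) (θ : Params)

/-- With candidates `{S,R1}`, the link S-D fails. -/
def evC (i : ℕ) : Set Ω := {ω | N.snrOverall1 i ω + N.snrSD i ω < θ.Gth}

/-- With candidates `{S,R1}`, the link R1-D fails. -/
def evD (i : ℕ) : Set Ω := {ω | N.snrOverall1 i ω + N.snrR1D i ω < θ.Gth}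

/-- With candidates `{S,R1,R2}`, the link S-D fails. -/
def evO (i : ℕ) : Set Ω := {ω | N.snrOverall3 i ω + N.snrSD i ω < θ.Gth}

/-- With candidates `{S,R1,R2}`, the link R2-D fails. -/
def evF (i : ℕ) : Set Ω := {ω | N.snrOverall3 i ω + N.snrR2D i ω < θ.Gth}

/-- With candidates `{S,R1,R2}`, the link R1-D fails. -/
def evG (i : ℕ) : Set Ω := {ω | N.snrOverall3 i ω + N.snrR1D i ω < θ.Gth}

/-- R2 holds enough energy to transmit. -/
def evU2 (i : ℕ) : Set Ω := {ω | θ.M2 ≤ N.B2 i ω}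

/-- The protocol calls for a transmission by R1 in slot `i`. R1 then transmits if and only if
moreover `B₁(i) ≥ M_{R1}`. -/
def called (i : ℕ) : Set Ω :=
  {ω | (N.tc i ω = TC.sr1 ∧ ω ∈ N.evC θ i ∧ ω ∉ N.evD θ i)
    ∨ (N.tc i ω = TC.sr1 ∧ ω ∈ N.evC θ i ∧ ω ∈ N.evD θ i
        ∧ N.snrSR2 i ω < θ.Gth ∧ θ.Gth ≤ N.snrR1R2 i ω)
    ∨ ((N.tc i ω).IsAll ∧ ω ∈ N.evU2 θ i ∧ ω ∈ N.evO θ i ∧ ω ∈ N.evF θ i ∧ ω ∉ N.evG θ i)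
    ∨ ((N.tc i ω).IsAll ∧ ω ∉ N.evU2 θ i ∧ ω ∈ N.evO θ i ∧ ω ∉ N.evG θ i)}

/-- The probabilistic model of the energy buffer of R1. The independence fields say that, within
each single slot, the stored energy, the harvested energy, the candidate set and the channel and
energy events that matter for that candidate set are mutually independent. Nothing is assumed on
the dependence between different slots beyond what the energy update forces. -/
structure IsModel [MeasurableSpace Ω] (P : Measure Ω) : Prop where
  measurable_tc : ∀ i, Measurable (N.tc i)
  measurable_overall1 : ∀ i, Measurable (N.snrOverall1 i)
  measurable_overall3 : ∀ i, Measurable (N.snrOverall3 i)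
  measurable_SD : ∀ i, Measurable (N.snrSD i)
  measurable_R1D : ∀ i, Measurable (N.snrR1D i)
  measurable_R2D : ∀ i, Measurable (N.snrR2D i)
  measurable_SR2 : ∀ i, Measurable (N.snrSR2 i)
  measurable_R1R2 : ∀ i, Measurable (N.snrR1R2 i)
  measurable_X : ∀ i, Measurable (N.X i)
  measurable_B1 : ∀ i, Measurable (N.B1 i)
  measurable_B2 : ∀ i, Measurable (N.B2 i)
  /-- the harvested energy and the two link SNRs are exponentially distributed -/
  law_X : ∀ i, P.map (N.X i) = expMeasure θ.lam1
  law_SR2 : ∀ i, P.map (N.snrSR2 i) = expMeasure θ.WSR2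
  law_R1R2 : ∀ i, P.map (N.snrR1R2 i) = expMeasure θ.WR1R2
  /-- the candidate sets and the failure events have the given probabilities -/
  prob_sr1 : ∀ i, P.real {ω | N.tc i ω = TC.sr1} = θ.pSR1
  prob_all1 : ∀ i, P.real {ω | N.tc i ω = TC.all1} = θ.p1
  prob_all2 : ∀ i, P.real {ω | N.tc i ω = TC.all2} = θ.p2
  prob_all3 : ∀ i, P.real {ω | N.tc i ω = TC.all3} = θ.p3
  prob_C : ∀ i, P.real (N.evC θ i) = θ.c
  prob_D : ∀ i, P.real (N.evD θ i) = θ.d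
  prob_O : ∀ i, P.real (N.evO θ i) = θ.o
  prob_F : ∀ i, P.real (N.evF θ i) = θ.f
  prob_G : ∀ i, P.real (N.evG θ i) = θ.g
  prob_U2 : ∀ i, P.real (N.evU2 θ i) = θ.PU2
  /-- independence within a slot of the quantities that matter for the candidates `{S,R1}` -/
  indep_sr1 : ∀ i, iIndep
    ![MeasurableSpace.comap (N.B1 i) inferInstance, MeasurableSpace.comap (N.X i) inferInstance,
      MeasurableSpace.comap (N.tc i) inferInstance,
      MeasurableSpace.generateFrom {N.evC θ i}, MeasurableSpace.generateFrom {N.evD θ i},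
      MeasurableSpace.comap (N.snrSR2 i) inferInstance,
      MeasurableSpace.comap (N.snrR1R2 i) inferInstance] P
  /-- independence within a slot of the quantities that matter for the candidates `{S,R1,R2}` -/
  indep_all : ∀ i, iIndep
    ![MeasurableSpace.comap (N.B1 i) inferInstance, MeasurableSpace.comap (N.X i) inferInstance,
      MeasurableSpace.comap (N.tc i) inferInstance,
      MeasurableSpace.generateFrom {N.evO θ i}, MeasurableSpace.generateFrom {N.evF θ i},
      MeasurableSpace.generateFrom {N.evG θ i}, MeasurableSpace.generateFrom {N.evU2 θ i}] P
  /-- the initial energy is nonnegative -/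
  nonneg_B1 : ∀ᵐ ω ∂P, 0 ≤ N.B1 0 ω
  /-- the energy update -/
  update : ∀ i, ∀ᵐ ω ∂P, N.B1 (i + 1) ω = θ.step (N.B1 i ω) (ω ∈ N.called θ i) (N.X i ω)

end Network

/-- Convergence of a sequence of finite measures in total variation (for probability measures with
densities: convergence of the densities in `L¹`). -/
def TendstoTV (μ : ℕ → Measure ℝ) (π : Measure ℝ) : Prop :=
  ∀ ε : ℝ, 0 < ε → ∃ n : ℕ, ∀ i ≥ n, ∀ A : Set ℝ, MeasurableSet A →
    |(μ i).real A - π.real A| ≤ ε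

end

end EHRelay

/-! Within a slot, the event that a discharge is called for is independent of the pair (stored
energy, harvest) and has probability b₁. Hence the law of the level evolves by the fixed map
`nextLaw`, with no independence between slots needed, and everything reduces to one Markov kernel on
[0,∞).

Stationarity. Let h be the density after a possible discharge and before the harvest. An exponential
harvest turns stationarity into g = h ∗ (λ₁e^{-λ₁x}), that is (e^{λ₁x}g)' = λ₁e^{λ₁x}h with g(0) =
0. This is a delay equation: g'(x) = λ₁b₁g(x+M) below M and g'(x) = λ₁b₁(g(x+M) − g(x)) above M,
with M = M_{R1}. The trial solution e^{Qx} above M requires b₁λ₁e^{QM} = b₁λ₁ + Q. For ψ > 1 this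
has a negative root, which the principal Lambert branch selects (`exp_Q1_mul_M1`, `Q1_neg`); the
same equation gives continuity at M and total mass 1.

Convergence. The kernel has the Lyapunov function e^{ax} with a = −Q₁/2, and its sublevel sets are
small because exponential laws shifted by bounded amounts share a common component
(`harrisCondition_bufferKernel`). A Harris theorem, proved by contraction of a weighted oscillation
seminorm, makes any two copies of the chain merge in total variation. Comparison with the stationary
copy gives convergence, and uniqueness follows. -/

section Harris

/-! ### Harris' theorem by contraction of a weighted oscillation -/

/-- A function whose oscillation is dominated by a weight becomes dominated by the weight after
subtraction of a constant. -/
lemma exists_abs_sub_le_of_sub_le_add {E : Type*} [Nonempty E] {φ w : E → ℝ}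
    (h : ∀ x y, φ x - φ y ≤ w x + w y) : ∃ m, ∀ x, |φ x - m| ≤ w x := by
  have hb : BddAbove (Set.range fun x => φ x - w x) := by
    refine ⟨φ (Classical.arbitrary E) + w (Classical.arbitrary E), ?_⟩
    rintro _ ⟨x, rfl⟩
    have := h x (Classical.arbitrary E)
    dsimp only
    linarith
  -- Every value of φ − w lies below every value of φ + w, so the supremum of the former separates
  -- the two.
  refine ⟨⨆ x, (φ x - w x), fun x => abs_le.2 ⟨?_, ?_⟩⟩
  · have : ⨆ y, (φ y - w y) ≤ φ x + w x := ciSup_le fun y => by linarith [h y x]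
    linarith
  · have := le_ciSup hb x
    linarith

variable {E : Type*} [MeasurableSpace E]

/-- If `η ≤ μ` then integrals against `μ - η` are dominated by the integral of the modulus. -/
lemma abs_integral_sub_integral_le_of_measure_le {μ η : Measure E} (hle : η ≤ μ) {ψ w : E → ℝ}
    (hψ : Integrable ψ μ) (hw : Integrable w μ) (h : ∀ x, |ψ x| ≤ w x) :
    |∫ x, ψ x ∂μ - ∫ x, ψ x ∂η| ≤ ∫ x, w x ∂μ - ∫ x, w x ∂η := by
  have hψ' := hψ.mono_measure hle
  have hw' := hw.mono_measure hle
  have h1 : ∫ x, (w x - ψ x) ∂η ≤ ∫ x, (w x - ψ x) ∂μ :=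
    integral_mono_measure hle
      (Filter.Eventually.of_forall fun x => sub_nonneg.2 ((le_abs_self _).trans (h x))) (hw.sub hψ)
  have h2 : ∫ x, (w x + ψ x) ∂η ≤ ∫ x, (w x + ψ x) ∂μ :=
    integral_mono_measure hle
      (Filter.Eventually.of_forall fun x => by
        have := neg_le_of_abs_le (h x)
        simp only [Pi.zero_apply]
        linarith) (hw.add hψ)
  rw [integral_sub hw hψ, integral_sub hw' hψ'] at h1
  rw [integral_add hw hψ, integral_add hw' hψ'] at h2
  exact abs_le.2 ⟨by linarith, by linarith⟩

variable (κ : Kernel E E)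

/-- The action of a kernel on functions. -/
noncomputable def kernelAct (φ : E → ℝ) (x : E) : ℝ := ∫ y, φ y ∂κ x

/-- Measurable functions with values in the unit interval. -/
def IsUnitTest (φ : E → ℝ) : Prop := Measurable φ ∧ ∀ x, φ x ∈ Set.Icc (0 : ℝ) 1

variable {κ}

lemma IsUnitTest.integrable {φ : E → ℝ} (hφ : IsUnitTest φ) (μ : Measure E) [IsFiniteMeasure μ] :
    Integrable φ μ :=
  Integrable.of_bound hφ.1.aestronglyMeasurable 1
    (Filter.Eventually.of_forall fun x => by
      rw [Real.norm_of_nonneg (hφ.2 x).1]; exact (hφ.2 x).2)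

lemma IsUnitTest.integral_mem {φ : E → ℝ} (hφ : IsUnitTest φ) (μ : Measure E)
    [IsProbabilityMeasure μ] : ∫ x, φ x ∂μ ∈ Set.Icc (0 : ℝ) 1 := by
  refine ⟨integral_nonneg fun x => (hφ.2 x).1, ?_⟩
  have := integral_mono (hφ.integrable μ) (integrable_const (1 : ℝ)) fun x => (hφ.2 x).2
  simpa using this

lemma IsUnitTest.kernelAct [IsMarkovKernel κ] {φ : E → ℝ} (hφ : IsUnitTest φ) :
    IsUnitTest (kernelAct κ φ) :=
  ⟨(hφ.1.stronglyMeasurable.integral_kernel (κ := κ)).measurable, fun x => hφ.integral_mem (κ x)⟩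

lemma IsUnitTest.iterate_kernelAct [IsMarkovKernel κ] {φ : E → ℝ} (hφ : IsUnitTest φ) (n : ℕ) :
    IsUnitTest ((_root_.kernelAct κ)^[n] φ) := by
  induction n generalizing φ with
  | zero => exact hφ
  | succ n ih => exact ih hφ.kernelAct

lemma integral_bind_eq_integral_kernelAct [IsMarkovKernel κ] (μ : Measure E)
    [IsProbabilityMeasure μ] {φ : E → ℝ} (hφ : IsUnitTest φ) :
    ∫ x, φ x ∂(μ.bind κ) = ∫ x, kernelAct κ φ x ∂μ := by
  have h : Integrable φ ((κ ∘ₖ Kernel.const Unit μ) ()) := hφ.integrable _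
  rw [Measure.comp_eq_comp_const_apply, Kernel.integral_comp h]
  rfl

/-- Duality between the evolution of laws and of test functions. -/
lemma integral_eq_integral_iterate_kernelAct [IsMarkovKernel κ] {μ : ℕ → Measure E}
    [IsProbabilityMeasure (μ 0)] (h : ∀ n, μ (n + 1) = (μ n).bind κ) {φ : E → ℝ}
    (hφ : IsUnitTest φ) (n : ℕ) :
    ∫ x, φ x ∂(μ n) = ∫ x, (kernelAct κ)^[n] φ x ∂(μ 0) := by
  have hp : ∀ n, IsProbabilityMeasure (μ n) := by
    intro n
    induction n with
    | zero => infer_instance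
    | succ n ih => rw [h]; infer_instance
  induction n generalizing φ with
  | zero => rfl
  | succ n ih =>
    rw [h, integral_bind_eq_integral_kernelAct _ hφ, ih hφ.kernelAct, Function.iterate_succ_apply]

/-- The data for geometric ergodicity: a Lyapunov function `V` whose sublevel sets are small. -/
structure HarrisCondition (κ : Kernel E E) (V : E → ℝ) (γ C : ℝ) : Prop where
  measurable : Measurable V
  nonneg : ∀ x, 0 ≤ V x
  integrable : ∀ x, Integrable V (κ x)
  rate_nonneg : 0 ≤ γ
  rate_lt_one : γ < 1
  const_nonneg : 0 ≤ C
  drift : ∀ x, ∫ y, V y ∂κ x ≤ γ * V x + C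
  minorization : ∀ R : ℝ, ∃ η : Measure E, 0 < η.real Set.univ ∧ ∀ x, V x ≤ R → η ≤ κ x

/-- A Markov kernel with a Lyapunov function and small sublevel sets contracts a weighted
oscillation seminorm. -/
lemma HarrisCondition.exists_contraction [IsMarkovKernel κ] {V : E → ℝ} {γ C : ℝ}
    (H : HarrisCondition κ V γ C) :
    ∃ α β : ℝ, 0 ≤ α ∧ α < 1 ∧ 0 < β ∧ ∀ (φ : E → ℝ) (c : ℝ), 0 ≤ c → IsUnitTest φ →
      (∀ x y, φ x - φ y ≤ c * (1 + β * V x) + c * (1 + β * V y)) →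
      ∀ x y, kernelAct κ φ x - kernelAct κ φ y
        ≤ (α * c) * (1 + β * V x) + (α * c) * (1 + β * V y) := by
  obtain ⟨η, hη, hηκ⟩ := H.minorization (4 * C / (1 - γ) + 1)
  have hγ := H.rate_lt_one
  have hγ0 := H.rate_nonneg
  have hC := H.const_nonneg
  have h1γ : 0 < 1 - γ := by linarith
  set ε := η.real Set.univ with hε
  -- The weight β is so small that the drift constants cost at most ε, half of the 2ε gained by
  -- minorization.
  set β := ε / (2 * (C + 1)) with hβ
  have hβ0 : 0 < β := by positivity
  have hβC : 2 * β * C ≤ ε := by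
    have : β * (2 * (C + 1)) = ε := by rw [hβ]; field_simp
    nlinarith
  -- The bound ε/2 serves the case of small S. The other two serve large S, where 2δ and δβS may
  -- each use a quarter of β(1 − γ)S, and 2βC uses half.
  obtain ⟨δ, hδ0, hδ1, hδ2, hδ3⟩ : ∃ δ : ℝ, 0 < δ ∧ δ ≤ ε / 2 ∧ δ ≤ (1 - γ) / 4 ∧
      δ ≤ β * (1 - γ) / 8 :=
    ⟨min (ε / 2) (min ((1 - γ) / 4) (β * (1 - γ) / 8)), by positivity, min_le_left _ _,
      (min_le_right _ _).trans (min_le_left _ _), (min_le_right _ _).trans (min_le_right _ _)⟩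
  refine ⟨1 - δ, β, by linarith, by linarith, hβ0, fun φ c hc hφ hosc x y => ?_⟩
  have : Nonempty E := ⟨x⟩
  obtain ⟨m, hm⟩ := exists_abs_sub_le_of_sub_le_add hosc
  have hψi : ∀ x, Integrable (fun z => φ z - m) (κ x) := fun x =>
    (hφ.integrable (κ x)).sub (integrable_const m)
  have hwi : ∀ x, Integrable (fun z => c * (1 + β * V z)) (κ x) := fun x =>
    (((integrable_const (1 : ℝ)).add ((H.integrable x).const_mul β)).const_mul c)
  have hact : ∀ x, ∫ z, (φ z - m) ∂κ x = kernelAct κ φ x - m := fun x => by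
    rw [integral_sub (hφ.integrable _) (integrable_const m)]; simp [kernelAct]
  have hwx : ∀ x, ∫ z, c * (1 + β * V z) ∂κ x ≤ c * (1 + β * (γ * V x + C)) := fun x => by
    rw [integral_const_mul, integral_add (integrable_const _) ((H.integrable x).const_mul β),
      integral_const_mul]
    simp only [integral_const, probReal_univ, smul_eq_mul, mul_one]
    have := H.drift x
    gcongr
  set S := V x + V y with hS
  have hVx := H.nonneg x
  have hVy := H.nonneg y
  -- For small S both points lie in the small set: the common part η cancels in the difference and
  -- saves at least cε on each side, since the weight is at least c. For large S the drift alone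
  -- suffices.
  rcases le_or_gt S (4 * C / (1 - γ) + 1) with hle | hgt
  · have hxle := hηκ x (by linarith)
    have hyle := hηκ y (by linarith)
    have : IsFiniteMeasure η := isFiniteMeasure_of_le (κ x) hxle
    have hηw : c * ε ≤ ∫ z, c * (1 + β * V z) ∂η := by
      have : ∫ z, c ∂η ≤ ∫ z, c * (1 + β * V z) ∂η :=
        integral_mono (integrable_const _) ((hwi x).mono_measure hxle) fun z => by
          have : 0 ≤ β * V z := mul_nonneg hβ0.le (H.nonneg z)
          dsimp only
          nlinarith
      simpa [hε, mul_comm] using this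
    have hx := abs_le.1 (abs_integral_sub_integral_le_of_measure_le hxle (hψi x) (hwi x) hm)
    have hy := abs_le.1 (abs_integral_sub_integral_le_of_measure_le hyle (hψi y) (hwi y) hm)
    rw [hact] at hx hy
    have hwx' := hwx x
    have hwy' := hwx y
    have key : (1 - ε) + (1 - ε) + β * γ * S + 2 * β * C ≤ (1 - δ) * (2 + β * S) := by
      have : δ * (β * S) ≤ (1 - γ) * (β * S) := by
        have : 0 ≤ β * S := by positivity
        gcongr; linarith
      nlinarith
    have key' := mul_le_mul_of_nonneg_left key hc
    have : kernelAct κ φ x - kernelAct κ φ y ≤ c * ((1 - ε) + (1 - ε) + β * γ * S + 2 * β * C) := by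
      rw [hS]; linarith [hx.2, hy.1]
    rw [hS] at key' this
    linarith
  · have hx := (abs_integral_le_integral_abs (f := fun z => φ z - m) (μ := κ x)).trans
      ((integral_mono (hψi x).abs (hwi x) hm).trans (hwx x))
    have hy := (abs_integral_le_integral_abs (f := fun z => φ z - m) (μ := κ y)).trans
      ((integral_mono (hψi y).abs (hwi y) hm).trans (hwx y))
    rw [hact] at hx hy
    have hx := abs_le.1 hx
    have hy := abs_le.1 hy
    have hS1 : 4 * C + (1 - γ) ≤ (1 - γ) * S := by
      have : (1 - γ) * (4 * C / (1 - γ) + 1) ≤ (1 - γ) * S := by gcongr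
      have h2 : (1 - γ) * (4 * C / (1 - γ) + 1) = 4 * C + (1 - γ) := by field_simp
      linarith
    have hS2 : 1 ≤ S := by
      have : 0 ≤ 4 * C / (1 - γ) := by positivity
      linarith
    have key : 2 + β * γ * S + 2 * β * C ≤ (1 - δ) * (2 + β * S) := by
      have e1 : δ * (β * S) ≤ (1 - γ) / 4 * (β * S) := by gcongr
      have e2 : β * (1 - γ) / 8 * 1 ≤ β * (1 - γ) / 8 * S := by gcongr
      have e3 : β * (4 * C) ≤ β * ((1 - γ) * S) :=
        mul_le_mul_of_nonneg_left (by linarith) hβ0.le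
      nlinarith
    have key' := mul_le_mul_of_nonneg_left key hc
    have : kernelAct κ φ x - kernelAct κ φ y ≤ c * (2 + β * γ * S + 2 * β * C) := by
      rw [hS]; linarith [hx.2, hy.1]
    rw [hS] at key' this
    linarith

/-- Under Harris' condition, the laws of two copies of the chain merge in total variation, whatever
the initial laws. -/
theorem HarrisCondition.tendsto_totalVariation [IsMarkovKernel κ] {V : E → ℝ} {γ C : ℝ}
    (H : HarrisCondition κ V γ C) {μ ν : ℕ → Measure E}
    [IsProbabilityMeasure (μ 0)] [IsProbabilityMeasure (ν 0)]
    (hμ : ∀ n, μ (n + 1) = (μ n).bind κ) (hν : ∀ n, ν (n + 1) = (ν n).bind κ)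
    {ε : ℝ} (hε : 0 < ε) :
    ∃ n : ℕ, ∀ i ≥ n, ∀ A : Set E, MeasurableSet A → |(μ i).real A - (ν i).real A| ≤ ε := by
  obtain ⟨α, β, hα0, hα1, hβ, hcontr⟩ := H.exists_contraction
  let w : E × E → ℝ := fun p => (1 + β * V p.1) + (1 + β * V p.2)
  have hVm := H.measurable
  have hwm : Measurable w := by fun_prop
  have hw0 : ∀ p, 0 ≤ w p := fun p => by
    have := mul_nonneg hβ.le (H.nonneg p.1)
    have := mul_nonneg hβ.le (H.nonneg p.2)
    simp only [w]; linarith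
  -- The cap at 1 allows arbitrary initial laws: V need not be integrable for them, yet dominated
  -- convergence applies.
  let b : ℕ → E × E → ℝ := fun n p => min 1 (α ^ n * w p)
  have hb0 : ∀ n p, 0 ≤ b n p := fun n p =>
    le_min zero_le_one (mul_nonneg (pow_nonneg hα0 n) (hw0 p))
  have hbm : ∀ n, Measurable (b n) := fun n => measurable_const.min (hwm.const_mul _)
  have hbi : ∀ n, Integrable (b n) ((μ 0).prod (ν 0)) := fun n =>
    Integrable.of_bound (hbm n).aestronglyMeasurable 1
      (Filter.Eventually.of_forall fun p => by
        rw [Real.norm_of_nonneg (hb0 n p)]; exact min_le_left _ _)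
  have hlim : Filter.Tendsto (fun n => ∫ p, b n p ∂((μ 0).prod (ν 0))) Filter.atTop (nhds 0) := by
    have := tendsto_integral_of_dominated_convergence (μ := (μ 0).prod (ν 0)) (F := b)
      (f := fun _ => 0) (fun _ => (1 : ℝ)) (fun n => (hbm n).aestronglyMeasurable)
      (integrable_const _)
      (fun n => Filter.Eventually.of_forall fun p => by
        rw [Real.norm_of_nonneg (hb0 n p)]; exact min_le_left _ _)
      (Filter.Eventually.of_forall fun p => by
        have h1 : Filter.Tendsto (fun n => α ^ n * w p) Filter.atTop (nhds 0) := by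
          simpa using (tendsto_pow_atTop_nhds_zero_of_lt_one hα0 hα1).mul_const (w p)
        have h2 := (tendsto_const_nhds (x := (1 : ℝ))).min h1
        simpa [b] using h2)
    simpa using this
  obtain ⟨n, hn⟩ := Filter.eventually_atTop.1 (hlim.eventually (ge_mem_nhds hε))
  refine ⟨n, fun i hi A hA => (le_trans ?_ (hn i hi))⟩
  have hφ : IsUnitTest (A.indicator fun _ => (1 : ℝ)) :=
    ⟨measurable_const.indicator hA, fun x => by
      by_cases hx : x ∈ A <;> simp [hx]⟩
  have hosc : ∀ (n : ℕ) x y, (kernelAct κ)^[n] (A.indicator fun _ => (1 : ℝ)) x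
      - (kernelAct κ)^[n] (A.indicator fun _ => (1 : ℝ)) y
      ≤ α ^ n * (1 + β * V x) + α ^ n * (1 + β * V y) := by
    intro n
    induction n with
    | zero =>
      intro x y
      have h1 := (hφ.2 x).2
      have h2 := (hφ.2 y).1
      have := mul_nonneg hβ.le (H.nonneg x)
      have := mul_nonneg hβ.le (H.nonneg y)
      simp only [Function.iterate_zero, id_eq, pow_zero]
      linarith
    | succ n ih =>
      rw [Function.iterate_succ_apply', pow_succ']
      exact hcontr _ _ (pow_nonneg hα0 n) (hφ.iterate_kernelAct n) ih
  set ψ := (kernelAct κ)^[i] (A.indicator fun _ => (1 : ℝ)) with hψdef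
  have hψ : IsUnitTest ψ := hφ.iterate_kernelAct i
  have eμ : (μ i).real A = ∫ x, ψ x ∂(μ 0) := by
    rw [← integral_eq_integral_iterate_kernelAct hμ hφ i, integral_indicator_const _ hA]; simp
  have eν : (ν i).real A = ∫ x, ψ x ∂(ν 0) := by
    rw [← integral_eq_integral_iterate_kernelAct hν hφ i, integral_indicator_const _ hA]; simp
  -- The independent coupling of the initial laws turns the pointwise oscillation bound into a bound
  -- for the difference.
  have hdiff : (μ i).real A - (ν i).real A
      = ∫ p, (ψ p.1 - ψ p.2) ∂((μ 0).prod (ν 0)) := by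
    rw [integral_sub ((hψ.integrable _).comp_fst (ν 0)) ((hψ.integrable _).comp_snd (μ 0)), eμ, eν,
      integral_fun_fst, integral_fun_snd]
    simp
  rw [hdiff]
  refine abs_integral_le_integral_abs.trans (integral_mono
    (((hψ.integrable _).comp_fst (ν 0)).sub ((hψ.integrable _).comp_snd (μ 0))).abs (hbi i) ?_)
  intro p
  have h1 := hψ.2 p.1
  have h2 := hψ.2 p.2
  refine le_min (abs_le.2 ⟨by linarith [h1.1, h2.2], by linarith [h1.2, h2.1]⟩)
    (abs_le.2 ⟨?_, ?_⟩)
  · have := hosc i p.2 p.1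
    simp only [w]; linarith
  · have := hosc i p.1 p.2
    simp only [w]; linarith

end Harris

/-! ### The Lambert function, the exponent and the density -/

namespace EHRelay

/-- On [−1, 0] the map w e^w runs from −1/e to 0, and p ≤ e^{p−1} puts −p e^{−p} in that range. The
intermediate value theorem then ensures that `Function.invFunOn` returns a genuine solution. -/
lemma lambertW_spec {p : ℝ} (hp : 1 < p) :
    -1 ≤ lambertW (-p * Real.exp (-p)) ∧
      lambertW (-p * Real.exp (-p)) * Real.exp (lambertW (-p * Real.exp (-p)))
        = -p * Real.exp (-p) := by
  have hex : ∃ w ∈ Set.Ici (-1 : ℝ), (fun w : ℝ => w * Real.exp w) w = -p * Real.exp (-p) := by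
    have hcont : ContinuousOn (fun w : ℝ => w * Real.exp w) (Set.Icc (-1) 0) := by fun_prop
    have hmem : -p * Real.exp (-p) ∈ Set.Icc ((fun w : ℝ => w * Real.exp w) (-1))
        ((fun w : ℝ => w * Real.exp w) 0) := by
      constructor
      · have h1 : p ≤ Real.exp (p - 1) := by linarith [Real.add_one_le_exp (p - 1)]
        have h2 : Real.exp (p - 1) * Real.exp (-p) = Real.exp (-1) := by
          rw [← Real.exp_add]; ring_nf
        have h3 := mul_le_mul_of_nonneg_right h1 (Real.exp_pos (-p)).le
        dsimp only
        linarith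
      · have := mul_pos (zero_lt_one.trans hp) (Real.exp_pos (-p))
        dsimp only
        linarith
    obtain ⟨w, hw, hwe⟩ := intermediate_value_Icc (by norm_num : (-1 : ℝ) ≤ 0) hcont hmem
    exact ⟨w, hw.1, hwe⟩
  exact ⟨Function.invFunOn_mem hex, Function.invFunOn_eq hex⟩

namespace Params

variable {θ : Params}

section Exponent

variable (hM : 0 < θ.M1) (hψ : 1 < θ.psi1)

include hM

lemma Q1_mul_M1 : θ.Q1 * θ.M1
    = -lambertW (-(θ.b1 * θ.lam1 * θ.M1) * Real.exp (-(θ.b1 * θ.lam1 * θ.M1)))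
      - θ.b1 * θ.lam1 * θ.M1 := by
  rw [Q1]; field_simp

include hψ

/-- With p = b₁λ₁M one has Q₁M = −W − p ≤ 1 − p < 0. The branch matters: the other solution W = −p
would give Q₁ = 0. -/
lemma Q1_neg : θ.Q1 < 0 := by
  have hp : 1 < θ.b1 * θ.lam1 * θ.M1 := by rw [psi1] at hψ; linarith
  have h := Q1_mul_M1 hM
  have hw := (lambertW_spec hp).1
  have : θ.Q1 * θ.M1 < 0 := by rw [h]; linarith
  exact neg_of_mul_neg_left this hM.le

/-- This is the characteristic equation of the delay equation for the density. With p = b₁λ₁M, the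
Lambert identity gives p e^{−W−p} = −W = Q₁M + p; division by M finishes. -/
lemma exp_Q1_mul_M1 :
    θ.b1 * θ.lam1 * Real.exp (θ.Q1 * θ.M1) = θ.b1 * θ.lam1 + θ.Q1 := by
  have hp : 1 < θ.b1 * θ.lam1 * θ.M1 := by rw [psi1] at hψ; linarith
  have h := Q1_mul_M1 hM
  have hw := (lambertW_spec hp).2
  set p := θ.b1 * θ.lam1 * θ.M1 with hpdef
  set W := lambertW (-p * Real.exp (-p))
  have h1 : p * Real.exp (θ.Q1 * θ.M1) = -W := by
    have h2 : Real.exp (θ.Q1 * θ.M1) = Real.exp (-W) * Real.exp (-p) := by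
      rw [h, ← Real.exp_add]; ring_nf
    have h3 : Real.exp W * Real.exp (-W) = 1 := by rw [← Real.exp_add]; simp
    rw [h2]
    linear_combination Real.exp (-W) * hw - W * h3
  have : (θ.b1 * θ.lam1 * Real.exp (θ.Q1 * θ.M1)) * θ.M1 = (θ.b1 * θ.lam1 + θ.Q1) * θ.M1 := by
    linear_combination h1 - h + (1 - Real.exp (θ.Q1 * θ.M1)) * hpdef
  exact mul_right_cancel₀ hM.ne' this

lemma b1_mul_lam1_pos : 0 < θ.b1 * θ.lam1 := by
  rw [psi1] at hψ
  have : 0 < (θ.b1 * θ.lam1) * θ.M1 := by linarith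
  exact pos_of_mul_pos_left this hM.le

lemma b1_mul_lam1_add_Q1_pos : 0 < θ.b1 * θ.lam1 + θ.Q1 := by
  rw [← exp_Q1_mul_M1 hM hψ]
  exact mul_pos (b1_mul_lam1_pos hM hψ) (Real.exp_pos _)

lemma g1_nonneg (x : ℝ) : 0 ≤ θ.g1 x := by
  have hQ := Q1_neg hM hψ
  have hbl := b1_mul_lam1_add_Q1_pos hM hψ
  unfold g1
  split_ifs with h1 h2
  · exact le_rfl
  · have : Real.exp (θ.Q1 * x) ≤ 1 := Real.exp_le_one_iff.2 (by nlinarith)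
    have : 0 ≤ 1 - Real.exp (θ.Q1 * x) := by linarith
    positivity
  · have : 0 < -θ.Q1 := by linarith
    positivity

end Exponent

lemma g1_of_neg {x : ℝ} (hx : x < 0) : θ.g1 x = 0 := if_pos hx

lemma g1_of_mem_Ico {x : ℝ} (hx : x ∈ Set.Ico 0 θ.M1) :
    θ.g1 x = 1 / θ.M1 * (1 - Real.exp (θ.Q1 * x)) := by
  rw [g1, if_neg (not_lt.2 hx.1), if_pos hx.2]

lemma g1_of_le (hM : 0 < θ.M1) {x : ℝ} (hx : θ.M1 ≤ x) :
    θ.g1 x = 1 / θ.M1 * (-θ.Q1 * Real.exp (θ.Q1 * x) / (θ.b1 * θ.lam1 + θ.Q1)) := by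
  rw [g1, if_neg (by linarith), if_neg (by linarith)]

lemma measurable_g1 : Measurable θ.g1 := by
  unfold g1
  refine Measurable.ite measurableSet_Iio measurable_const
    (Measurable.ite measurableSet_Iio (by fun_prop) (by fun_prop))

/-! ### Total mass and tail of the limiting law -/

section Integrals

variable (hM : 0 < θ.M1) (hψ : 1 < θ.psi1)

lemma integrableOn_g1_Ico : IntegrableOn θ.g1 (Set.Ico 0 θ.M1) := by
  have : IntegrableOn (fun x => 1 / θ.M1 * (1 - Real.exp (θ.Q1 * x))) (Set.Ico 0 θ.M1) :=
    (Continuous.integrableOn_Icc (by fun_prop)).mono_set Set.Ico_subset_Icc_self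
  exact this.congr_fun (fun x hx => (g1_of_mem_Ico hx).symm) measurableSet_Ico

lemma limitLaw_Iio_zero : θ.limitLaw (Set.Iio 0) = 0 := by
  rw [limitLaw, withDensity_apply _ measurableSet_Iio,
    setLIntegral_congr_fun (g := fun _ => 0) measurableSet_Iio
      (fun x hx => by simp [g1_of_neg hx])]
  simp

include hM hψ

lemma integrableOn_g1_Ici : IntegrableOn θ.g1 (Set.Ici θ.M1) := by
  rw [integrableOn_Ici_iff_integrableOn_Ioi]
  refine IntegrableOn.congr_fun (((integrableOn_exp_mul_Ioi (Q1_neg hM hψ) θ.M1).const_mul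
    (1 / θ.M1 * (-θ.Q1 / (θ.b1 * θ.lam1 + θ.Q1))))) (fun x hx => ?_) measurableSet_Ioi
  rw [g1_of_le hM (le_of_lt hx)]; ring

/-- The integral of e^{Q₁x} produces −e^{Q₁M}/Q₁; by the characteristic equation e^{Q₁M} =
(b₁λ₁+Q₁)/(b₁λ₁), which cancels the normalisation. -/
lemma integral_g1_Ici : ∫ x in Set.Ici θ.M1, θ.g1 x = 1 / (θ.b1 * θ.lam1 * θ.M1) := by
  have hQ := (Q1_neg hM hψ).ne
  have hbl := (b1_mul_lam1_add_Q1_pos hM hψ).ne'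
  have hbl' := (b1_mul_lam1_pos hM hψ).ne'
  have hE := exp_Q1_mul_M1 hM hψ
  have heq : ∀ x ∈ Set.Ioi θ.M1, θ.g1 x
      = 1 / θ.M1 * (-θ.Q1 / (θ.b1 * θ.lam1 + θ.Q1)) * Real.exp (θ.Q1 * x) := fun x hx => by
    rw [g1_of_le hM (le_of_lt hx)]; ring
  rw [integral_Ici_eq_integral_Ioi, setIntegral_congr_fun measurableSet_Ioi heq,
    integral_const_mul, integral_exp_mul_Ioi (Q1_neg hM hψ)]
  have hexp : Real.exp (θ.Q1 * θ.M1) = (θ.b1 * θ.lam1 + θ.Q1) / (θ.b1 * θ.lam1) := by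
    rw [← hE, mul_div_cancel_left₀ _ hbl']
  rw [hexp]
  have := hM.ne'
  field_simp

/-- The characteristic equation gives (e^{Q₁M} − 1)/Q₁ = 1/(b₁λ₁), so this part is the exact
complement of the tail. -/
lemma integral_g1_Ico :
    ∫ x in Set.Ico 0 θ.M1, θ.g1 x = 1 - 1 / (θ.b1 * θ.lam1 * θ.M1) := by
  have hQ := (Q1_neg hM hψ).ne
  have hbl' := (b1_mul_lam1_pos hM hψ).ne'
  have hE := exp_Q1_mul_M1 hM hψ
  have hM' := hM.ne'
  have hexp : Real.exp (θ.Q1 * θ.M1) = (θ.b1 * θ.lam1 + θ.Q1) / (θ.b1 * θ.lam1) := by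
    rw [← hE, mul_div_cancel_left₀ _ hbl']
  rw [setIntegral_congr_fun measurableSet_Ico (fun x hx => g1_of_mem_Ico hx),
    integral_Ico_eq_integral_Ioc, ← intervalIntegral.integral_of_le hM.le,
    intervalIntegral.integral_const_mul, intervalIntegral.integral_sub (by simp)
      (Continuous.intervalIntegrable (by fun_prop) _ _),
    intervalIntegral.integral_comp_mul_left (fun x => Real.exp x) hQ, integral_exp]
  simp only [intervalIntegral.integral_const, smul_eq_mul, mul_zero, Real.exp_zero, hexp]
  have hb := left_ne_zero_of_mul hbl'
  have hl := right_ne_zero_of_mul hbl'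
  field_simp
  ring

lemma hasIntegral_g1 : Integrable θ.g1 ∧ ∫ x, θ.g1 x = 1 := by
  have h0 : IntegrableOn θ.g1 (Set.Iio 0) :=
    (integrableOn_zero (ε' := ℝ)).congr_fun (fun x hx => (g1_of_neg hx).symm) measurableSet_Iio
  have h1 : IntegrableOn θ.g1 (Set.Ici 0) := by
    rw [← Set.Ico_union_Ici_eq_Ici hM.le]
    exact integrableOn_g1_Ico.union (integrableOn_g1_Ici hM hψ)
  have hint : Integrable θ.g1 := by
    rw [← integrableOn_univ, ← Set.Iio_union_Ici (a := (0 : ℝ))]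
    exact h0.union h1
  have hdisj : Disjoint (Set.Ico 0 θ.M1) (Set.Ici θ.M1) :=
    Set.disjoint_left.2 fun x hx hx' => not_le.2 hx.2 hx'
  refine ⟨hint, ?_⟩
  rw [← setIntegral_univ, ← Set.Iio_union_Ici (a := (0 : ℝ)),
    setIntegral_union (Set.Iio_disjoint_Ici le_rfl) measurableSet_Ici h0 h1,
    setIntegral_congr_fun measurableSet_Iio (fun x hx => g1_of_neg hx),
    ← Set.Ico_union_Ici_eq_Ici hM.le,
    setIntegral_union hdisj measurableSet_Ici
      integrableOn_g1_Ico (integrableOn_g1_Ici hM hψ),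
    integral_g1_Ico hM hψ, integral_g1_Ici hM hψ]
  simp

lemma isProbabilityMeasure_limitLaw : IsProbabilityMeasure θ.limitLaw := by
  obtain ⟨hi, h1⟩ := hasIntegral_g1 hM hψ
  refine ⟨?_⟩
  rw [limitLaw, withDensity_apply _ MeasurableSet.univ, setLIntegral_univ,
    ← ofReal_integral_eq_lintegral_ofReal hi (Filter.Eventually.of_forall (g1_nonneg hM hψ)), h1,
    ENNReal.ofReal_one]

lemma limitLaw_real_Ici : θ.limitLaw.real (Set.Ici θ.M1) = 1 / (θ.b1 * θ.lam1 * θ.M1) := by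
  rw [← integral_g1_Ici hM hψ, measureReal_def, limitLaw, withDensity_apply _ measurableSet_Ici,
    ← ofReal_integral_eq_lintegral_ofReal (integrableOn_g1_Ici hM hψ)
      (Filter.Eventually.of_forall (g1_nonneg hM hψ)),
    ENNReal.toReal_ofReal (integral_nonneg (g1_nonneg hM hψ))]

end Integrals

end Params

end EHRelay

/-! ### Exponential tails and product rule for seven independent events -/

lemma withDensity_exponentialPDF (r : ℝ) :
    expMeasure r = volume.withDensity (exponentialPDF r) := rfl

lemma expMeasure_real_Iio {r x : ℝ} (hr : 0 < r) (hx : 0 ≤ x) :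
    (expMeasure r).real (Set.Iio x) = 1 - Real.exp (-r * x) := by
  have := isProbabilityMeasure_expMeasure hr
  have hae : (Set.Iio x : Set ℝ) =ᵐ[expMeasure r] Set.Iic x := by
    rw [withDensity_exponentialPDF]
    exact (withDensity_absolutelyContinuous _ _).ae_eq Iio_ae_eq_Iic
  rw [measureReal_congr hae, ← cdf_eq_real, cdf_expMeasure_eq hr, if_pos hx, neg_mul]

lemma expMeasure_real_Ici {r x : ℝ} (hr : 0 < r) (hx : 0 ≤ x) :
    (expMeasure r).real (Set.Ici x) = Real.exp (-r * x) := by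
  have := isProbabilityMeasure_expMeasure hr
  rw [← Set.compl_Iio, probReal_compl_eq_one_sub measurableSet_Iio, expMeasure_real_Iio hr hx]
  ring

lemma ProbabilityTheory.iIndep.measureReal_inter_seven {Ω : Type*} [MeasurableSpace Ω]
    {P : Measure Ω} {m : Fin 7 → MeasurableSpace Ω} (h : iIndep m P) {s : Fin 7 → Set Ω}
    (hs : ∀ i, MeasurableSet[m i] (s i)) :
    P.real (s 0 ∩ s 1 ∩ s 2 ∩ s 3 ∩ s 4 ∩ s 5 ∩ s 6)
      = P.real (s 0) * P.real (s 1) * P.real (s 2) * P.real (s 3) * P.real (s 4) * P.real (s 5)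
        * P.real (s 6) := by
  have hset : s 0 ∩ s 1 ∩ s 2 ∩ s 3 ∩ s 4 ∩ s 5 ∩ s 6 = ⋂ i, s i := by
    ext ω
    simp only [Set.mem_inter_iff, Set.mem_iInter, Fin.forall_fin_succ, Fin.forall_fin_zero]
    simp [and_assoc]
  rw [hset, measureReal_def, h.meas_iInter hs, ENNReal.toReal_prod]
  simp only [← measureReal_def]
  simp [Fin.prod_univ_succ, mul_assoc]

/-! ### The discharge event and the evolution of laws -/

namespace EHRelay

lemma measurable_step (θ : Params) (p : Prop) :
    Measurable fun q : ℝ × ℝ => θ.step q.1 p q.2 := by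
  classical
  unfold Params.step
  by_cases hp : p
  · simp only [hp, true_and]
    exact Measurable.ite (measurableSet_le measurable_const measurable_fst)
      (by fun_prop) (by fun_prop)
  · simp only [hp, false_and, if_false]
    fun_prop

namespace Network

/-- The events are put in the order of the two independence families, so that each case is a
sevenfold intersection once absent coordinates are filled with `Set.univ`. -/
lemma called_eq {Ω : Type*} (N : Network Ω) (θ : Params) (i : ℕ) : N.called θ i
    = (({ω | N.tc i ω = TC.sr1} ∩ N.evC θ i ∩ (N.evD θ i)ᶜ
      ∪ {ω | N.tc i ω = TC.sr1} ∩ N.evC θ i ∩ N.evD θ i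
          ∩ {ω | N.snrSR2 i ω < θ.Gth} ∩ {ω | θ.Gth ≤ N.snrR1R2 i ω})
      ∪ {ω | (N.tc i ω).IsAll} ∩ N.evO θ i ∩ N.evF θ i ∩ (N.evG θ i)ᶜ ∩ N.evU2 θ i)
      ∪ {ω | (N.tc i ω).IsAll} ∩ N.evO θ i ∩ (N.evG θ i)ᶜ ∩ (N.evU2 θ i)ᶜ := by
  ext ω
  simp only [called, Set.mem_inter_iff, Set.mem_union, Set.mem_ofPred_eq, Set.mem_compl_iff,
    or_assoc, and_assoc]
  rw [and_comm (a := ω ∈ N.evU2 θ i), and_comm (a := ω ∉ N.evU2 θ i)]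
  simp only [and_assoc]

section Events

variable {Ω : Type*} [MeasurableSpace Ω] {P : Measure Ω} {N : Network Ω} {θ : Params}
variable (hN : N.IsModel θ P) (i : ℕ)

include hN

lemma IsModel.measurableSet_evC : MeasurableSet (N.evC θ i) :=
  measurableSet_lt ((hN.measurable_overall1 i).add (hN.measurable_SD i)) measurable_const

lemma IsModel.measurableSet_evD : MeasurableSet (N.evD θ i) :=
  measurableSet_lt ((hN.measurable_overall1 i).add (hN.measurable_R1D i)) measurable_const

lemma IsModel.measurableSet_evO : MeasurableSet (N.evO θ i) :=
  measurableSet_lt ((hN.measurable_overall3 i).add (hN.measurable_SD i)) measurable_const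

lemma IsModel.measurableSet_evF : MeasurableSet (N.evF θ i) :=
  measurableSet_lt ((hN.measurable_overall3 i).add (hN.measurable_R2D i)) measurable_const

lemma IsModel.measurableSet_evG : MeasurableSet (N.evG θ i) :=
  measurableSet_lt ((hN.measurable_overall3 i).add (hN.measurable_R1D i)) measurable_const

lemma IsModel.measurableSet_evU2 : MeasurableSet (N.evU2 θ i) :=
  measurableSet_le measurable_const (hN.measurable_B2 i)

lemma IsModel.measurableSet_tc (T : Set TC) : MeasurableSet {ω | N.tc i ω ∈ T} :=
  hN.measurable_tc i (MeasurableSpace.measurableSet_top (s := T))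

lemma IsModel.measurableSet_called : MeasurableSet (N.called θ i) := by
  have h1 := hN.measurableSet_tc i {TC.sr1}
  have h2 := hN.measurableSet_tc i {t | t.IsAll}
  have hC := hN.measurableSet_evC i
  have hD := hN.measurableSet_evD i
  have hO := hN.measurableSet_evO i
  have hF := hN.measurableSet_evF i
  have hG := hN.measurableSet_evG i
  have hU := hN.measurableSet_evU2 i
  have hS : MeasurableSet {ω | N.snrSR2 i ω < θ.Gth} :=
    measurableSet_lt (hN.measurable_SR2 i) measurable_const
  have hR : MeasurableSet {ω | θ.Gth ≤ N.snrR1R2 i ω} :=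
    measurableSet_le measurable_const (hN.measurable_R1R2 i)
  exact (h1.inter (hC.inter hD.compl)).union ((h1.inter (hC.inter (hD.inter (hS.inter hR)))).union
    ((h2.inter (hU.inter (hO.inter (hF.inter hG.compl)))).union
      (h2.inter (hU.compl.inter (hO.inter hG.compl)))))

lemma IsModel.indepFun_B1_X : IndepFun (N.B1 i) (N.X i) P :=
  (hN.indep_sr1 i).indep (i := 0) (j := 1) (by decide)

variable [IsProbabilityMeasure P]

lemma IsModel.prob_isAll : P.real {ω | (N.tc i ω).IsAll} = θ.p1 + θ.p2 + θ.p3 := by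
  have hset : {ω | (N.tc i ω).IsAll}
      = ({ω | N.tc i ω = TC.all1} ∪ {ω | N.tc i ω = TC.all2}) ∪ {ω | N.tc i ω = TC.all3} := by
    ext ω
    simp [TC.IsAll, or_assoc]
  have h2 : MeasurableSet {ω | N.tc i ω = TC.all2} := hN.measurableSet_tc i {TC.all2}
  have h3 : MeasurableSet {ω | N.tc i ω = TC.all3} := hN.measurableSet_tc i {TC.all3}
  rw [hset, measureReal_union _ h3, measureReal_union _ h2, hN.prob_all1, hN.prob_all2,
    hN.prob_all3]
  · exact Set.disjoint_left.2 fun ω h h' => by simp_all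
  · refine Set.disjoint_left.2 fun ω h h' => ?_
    rcases h with h | h <;> simp_all

/-- Whether a transmission is called for is independent of the stored and the harvested energy,
and has probability `b₁`. -/
lemma IsModel.measureReal_inter_called (hR0 : 0 ≤ θ.R0) (hWSR2 : 0 < θ.WSR2)
    (hWR1R2 : 0 < θ.WR1R2) {A B : Set ℝ} (hA : MeasurableSet A) (hB : MeasurableSet B) :
    P.real (N.B1 i ⁻¹' A ∩ N.X i ⁻¹' B ∩ N.called θ i)
      = P.real (N.B1 i ⁻¹' A) * P.real (N.X i ⁻¹' B) * θ.b1 := by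
  have hG0 : 0 ≤ θ.Gth := by
    have := Real.one_le_rpow (by norm_num : (1 : ℝ) ≤ 2) hR0
    rw [Params.Gth]; linarith
  have hC := hN.measurableSet_evC i
  have hD := hN.measurableSet_evD i
  have hO := hN.measurableSet_evO i
  have hF := hN.measurableSet_evF i
  have hG := hN.measurableSet_evG i
  have hU := hN.measurableSet_evU2 i
  have hS : MeasurableSet {ω | N.snrSR2 i ω < θ.Gth} :=
    measurableSet_lt (hN.measurable_SR2 i) measurable_const
  have hR : MeasurableSet {ω | θ.Gth ≤ N.snrR1R2 i ω} :=
    measurableSet_le measurable_const (hN.measurable_R1R2 i)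
  have hT1 := hN.measurableSet_tc i {TC.sr1}
  have hTa := hN.measurableSet_tc i {t | t.IsAll}
  have hBm := hN.measurable_B1 i hA
  have hXm := hN.measurable_X i hB
  have pS : P.real {ω | N.snrSR2 i ω < θ.Gth} = 1 - Real.exp (-θ.WSR2 * θ.Gth) := by
    rw [← expMeasure_real_Iio hWSR2 hG0, ← hN.law_SR2 i,
      map_measureReal_apply (hN.measurable_SR2 i) measurableSet_Iio]
    rfl
  have pR : P.real {ω | θ.Gth ≤ N.snrR1R2 i ω} = Real.exp (-θ.WR1R2 * θ.Gth) := by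
    rw [← expMeasure_real_Ici hWR1R2 hG0, ← hN.law_R1R2 i,
      map_measureReal_apply (hN.measurable_R1R2 i) measurableSet_Ici]
    rfl
  have gen : ∀ s : Set Ω, MeasurableSet[MeasurableSpace.generateFrom {s}] s := fun s =>
    MeasurableSpace.measurableSet_generateFrom rfl
  have e1 := (hN.indep_sr1 i).measureReal_inter_seven
    (s := ![N.B1 i ⁻¹' A, N.X i ⁻¹' B, {ω | N.tc i ω = TC.sr1}, N.evC θ i, (N.evD θ i)ᶜ,
      Set.univ, Set.univ]) (by
    simp only [Fin.forall_fin_succ, Fin.forall_fin_zero]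
    exact ⟨⟨A, hA, rfl⟩, ⟨B, hB, rfl⟩, ⟨{TC.sr1}, MeasurableSpace.measurableSet_top, rfl⟩, gen _,
      (gen _).compl, MeasurableSet.univ, MeasurableSet.univ, trivial⟩)
  have e2 := (hN.indep_sr1 i).measureReal_inter_seven
    (s := ![N.B1 i ⁻¹' A, N.X i ⁻¹' B, {ω | N.tc i ω = TC.sr1}, N.evC θ i, N.evD θ i,
      {ω | N.snrSR2 i ω < θ.Gth}, {ω | θ.Gth ≤ N.snrR1R2 i ω}]) (by
    simp only [Fin.forall_fin_succ, Fin.forall_fin_zero]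
    exact ⟨⟨A, hA, rfl⟩, ⟨B, hB, rfl⟩, ⟨{TC.sr1}, MeasurableSpace.measurableSet_top, rfl⟩, gen _,
      gen _, ⟨Set.Iio θ.Gth, measurableSet_Iio, rfl⟩, ⟨Set.Ici θ.Gth, measurableSet_Ici, rfl⟩,
      trivial⟩)
  have e3 := (hN.indep_all i).measureReal_inter_seven
    (s := ![N.B1 i ⁻¹' A, N.X i ⁻¹' B, {ω | (N.tc i ω).IsAll}, N.evO θ i, N.evF θ i,
      (N.evG θ i)ᶜ, N.evU2 θ i]) (by
    simp only [Fin.forall_fin_succ, Fin.forall_fin_zero]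
    exact ⟨⟨A, hA, rfl⟩, ⟨B, hB, rfl⟩, ⟨{t | t.IsAll}, MeasurableSpace.measurableSet_top, rfl⟩,
      gen _, gen _, (gen _).compl, gen _, trivial⟩)
  have e4 := (hN.indep_all i).measureReal_inter_seven
    (s := ![N.B1 i ⁻¹' A, N.X i ⁻¹' B, {ω | (N.tc i ω).IsAll}, N.evO θ i, Set.univ,
      (N.evG θ i)ᶜ, (N.evU2 θ i)ᶜ]) (by
    simp only [Fin.forall_fin_succ, Fin.forall_fin_zero]
    exact ⟨⟨A, hA, rfl⟩, ⟨B, hB, rfl⟩, ⟨{t | t.IsAll}, MeasurableSpace.measurableSet_top, rfl⟩,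
      gen _, MeasurableSet.univ, (gen _).compl, (gen _).compl, trivial⟩)
  simp only [Matrix.cons_val, Set.inter_univ, probReal_univ, mul_one,
    probReal_compl_eq_one_sub hD, probReal_compl_eq_one_sub hG, probReal_compl_eq_one_sub hU,
    hN.prob_sr1, hN.prob_C, hN.prob_D, hN.prob_O, hN.prob_F, hN.prob_G, hN.prob_U2,
    hN.prob_isAll i, pS, pR] at e1 e2 e3 e4
  set E := N.B1 i ⁻¹' A ∩ N.X i ⁻¹' B with hE
  have hEm : MeasurableSet E := hBm.inter hXm
  have hset : E ∩ N.called θ i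
      = ((E ∩ {ω | N.tc i ω = TC.sr1} ∩ N.evC θ i ∩ (N.evD θ i)ᶜ
        ∪ E ∩ {ω | N.tc i ω = TC.sr1} ∩ N.evC θ i ∩ N.evD θ i
            ∩ {ω | N.snrSR2 i ω < θ.Gth} ∩ {ω | θ.Gth ≤ N.snrR1R2 i ω})
        ∪ E ∩ {ω | (N.tc i ω).IsAll} ∩ N.evO θ i ∩ N.evF θ i ∩ (N.evG θ i)ᶜ ∩ N.evU2 θ i)
        ∪ E ∩ {ω | (N.tc i ω).IsAll} ∩ N.evO θ i ∩ (N.evG θ i)ᶜ ∩ (N.evU2 θ i)ᶜ := by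
    rw [called_eq]
    simp only [Set.inter_union_distrib_left, Set.inter_assoc, Set.union_assoc]
  have hne : ∀ ω, N.tc i ω = TC.sr1 → ¬ (N.tc i ω).IsAll := fun ω h => by
    simp [h, TC.IsAll]
  -- The four cases are disjoint: the first two differ in D, the last two in U₂, and the two pairs
  -- in the candidate set.
  rw [hset, measureReal_union, measureReal_union, measureReal_union, e1, e2, e3, e4, Params.b1]
  · ring
  · refine Set.disjoint_left.2 fun ω h h' => ?_
    simp only [Set.mem_inter_iff, Set.mem_compl_iff] at h h'
    tauto
  · exact ((((hEm.inter hT1).inter hC).inter hD).inter hS).inter hR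
  · refine Set.disjoint_left.2 fun ω h h' => ?_
    have := hne ω
    simp only [Set.mem_inter_iff, Set.mem_union, Set.mem_compl_iff, Set.mem_ofPred_eq] at h h'
    tauto
  · exact ((((hEm.inter hTa).inter hO).inter hF).inter hG.compl).inter hU
  · refine Set.disjoint_left.2 fun ω h h' => ?_
    have := hne ω
    simp only [Set.mem_inter_iff, Set.mem_union, Set.mem_compl_iff, Set.mem_ofPred_eq] at h h'
    tauto
  · exact (((hEm.inter hTa).inter hO).inter hG.compl).inter hU.compl

lemma IsModel.measureReal_called (hR0 : 0 ≤ θ.R0) (hWSR2 : 0 < θ.WSR2)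
    (hWR1R2 : 0 < θ.WR1R2) : P.real (N.called θ i) = θ.b1 := by
  simpa using hN.measureReal_inter_called i hR0 hWSR2 hWR1R2 (A := Set.univ) (B := Set.univ)
    MeasurableSet.univ MeasurableSet.univ

/-- Independence from the discharge event is recast as an identity of measures, checked on
rectangles. The complement comes by subtraction from the independence of stored and harvested
energy. -/
lemma IsModel.map_restrict_called (hR0 : 0 ≤ θ.R0) (hWSR2 : 0 < θ.WSR2)
    (hWR1R2 : 0 < θ.WR1R2) (hlam : 0 < θ.lam1) :
    (P.restrict (N.called θ i)).map (fun ω => (N.B1 i ω, N.X i ω))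
        = ENNReal.ofReal θ.b1 • (P.map (N.B1 i)).prod (expMeasure θ.lam1) ∧
      (P.restrict (N.called θ i)ᶜ).map (fun ω => (N.B1 i ω, N.X i ω))
        = ENNReal.ofReal (1 - θ.b1) • (P.map (N.B1 i)).prod (expMeasure θ.lam1) := by
  have := isProbabilityMeasure_expMeasure hlam
  have hBm := hN.measurable_B1 i
  have hXm := hN.measurable_X i
  have := Measure.isProbabilityMeasure_map (μ := P) hBm.aemeasurable
  have hcalled := hN.measurableSet_called i
  have hb := hN.measureReal_called i hR0 hWSR2 hWR1R2
  have hb0 : 0 ≤ θ.b1 := hb ▸ measureReal_nonneg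
  have hb1 : 0 ≤ 1 - θ.b1 := sub_nonneg.2 (hb ▸ measureReal_le_one)
  have hind : ∀ {s t : Set ℝ}, MeasurableSet s → MeasurableSet t →
      P.real (N.B1 i ⁻¹' s ∩ N.X i ⁻¹' t) = P.real (N.B1 i ⁻¹' s) * P.real (N.X i ⁻¹' t) := by
    intro s t hs ht
    simp only [measureReal_def, (hN.indepFun_B1_X i).measure_inter_preimage_eq_mul s t hs ht,
      ENNReal.toReal_mul]
  have hpair : Measurable fun ω => (N.B1 i ω, N.X i ω) := hBm.prodMk hXm
  have hfin : ∀ b : ℝ, IsFiniteMeasure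
      (ENNReal.ofReal b • (P.map (N.B1 i)).prod (expMeasure θ.lam1)) := fun b =>
    Measure.smul_finite _ ENNReal.ofReal_ne_top
  constructor
  · refine Measure.ext_prod fun {s t} hs ht => ?_
    have := hfin θ.b1
    rw [← measureReal_eq_measureReal_iff, map_measureReal_apply hpair (hs.prod ht),
      measureReal_restrict_apply (hpair (hs.prod ht)), measureReal_ennreal_smul_apply,
      measureReal_prod_prod, ← hN.law_X i, map_measureReal_apply hBm hs,
      map_measureReal_apply hXm ht, ENNReal.toReal_ofReal hb0, Set.mk_preimage_prod,
      hN.measureReal_inter_called i hR0 hWSR2 hWR1R2 hs ht]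
    ring
  · refine Measure.ext_prod fun {s t} hs ht => ?_
    have := hfin (1 - θ.b1)
    rw [← measureReal_eq_measureReal_iff, map_measureReal_apply hpair (hs.prod ht),
      measureReal_restrict_apply (hpair (hs.prod ht)), measureReal_ennreal_smul_apply,
      measureReal_prod_prod, ← hN.law_X i, map_measureReal_apply hBm hs,
      map_measureReal_apply hXm ht, ENNReal.toReal_ofReal hb1, Set.mk_preimage_prod]
    have h1 := hN.measureReal_inter_called i hR0 hWSR2 hWR1R2 hs ht
    have h2 := hind hs ht
    have h3 := measureReal_inter_add_sdiff (μ := P) (s := N.B1 i ⁻¹' s ∩ N.X i ⁻¹' t) hcalled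
    rw [Set.sdiff_eq] at h3
    linarith

/-- The law of the stored energy evolves by the energy update. -/
lemma IsModel.map_B1_succ (hR0 : 0 ≤ θ.R0) (hWSR2 : 0 < θ.WSR2)
    (hWR1R2 : 0 < θ.WR1R2) (hlam : 0 < θ.lam1) :
    P.map (N.B1 (i + 1)) = θ.nextLaw (P.map (N.B1 i)) := by
  obtain ⟨h1, h2⟩ := hN.map_restrict_called i hR0 hWSR2 hWR1R2 hlam
  have hcalled := hN.measurableSet_called i
  have hpair : Measurable fun ω => (N.B1 i ω, N.X i ω) :=
    (hN.measurable_B1 i).prodMk (hN.measurable_X i)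
  have hT := measurable_step θ True
  have hF := measurable_step θ False
  rw [Params.nextLaw, ← Measure.map_smul, ← Measure.map_smul, ← h1, ← h2,
    Measure.map_map hT hpair, Measure.map_map hF hpair]
  have e1 : (P.restrict (N.called θ i)).map (N.B1 (i + 1)) = (P.restrict (N.called θ i)).map
      ((fun q : ℝ × ℝ => θ.step q.1 True q.2) ∘ fun ω => (N.B1 i ω, N.X i ω)) := by
    refine Measure.map_congr ?_
    filter_upwards [ae_restrict_of_ae (hN.update i), ae_restrict_mem hcalled] with ω hω hc
    simp [hω, hc]
  have e2 : (P.restrict (N.called θ i)ᶜ).map (N.B1 (i + 1)) = (P.restrict (N.called θ i)ᶜ).map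
      ((fun q : ℝ × ℝ => θ.step q.1 False q.2) ∘ fun ω => (N.B1 i ω, N.X i ω)) := by
    refine Measure.map_congr ?_
    filter_upwards [ae_restrict_of_ae (hN.update i), ae_restrict_mem hcalled.compl] with ω hω hc
    have hc' : ω ∉ N.called θ i := hc
    simp [hω, hc']
  rw [← e1, ← e2, ← Measure.map_add _ _ (hN.measurable_B1 (i + 1)),
    Measure.restrict_add_restrict_compl hcalled]

end Events

end Network

end EHRelay

/-! ### Exponential moments and shifts of the harvest -/

instance (r : ℝ) : SFinite (expMeasure r) :=
  inferInstanceAs (SFinite (volume.withDensity (gammaPDF 1 r)))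

lemma measurable_exponentialPDF (r : ℝ) : Measurable (exponentialPDF r) :=
  (measurable_exponentialPDFReal r).ennreal_ofReal

lemma expMeasure_Iio_zero (r : ℝ) : expMeasure r (Set.Iio 0) = 0 := by
  rw [withDensity_exponentialPDF, withDensity_apply _ measurableSet_Iio,
    lintegral_exponentialPDF_of_nonpos le_rfl]

lemma ae_nonneg_expMeasure (r : ℝ) : ∀ᵐ e ∂expMeasure r, 0 ≤ e := by
  rw [ae_iff]
  simpa only [not_le] using! expMeasure_Iio_zero r

/-- The moment generating function of the exponential distribution. -/
lemma integral_exp_mul_expMeasure {r a : ℝ} (hr : 0 < r) (ha : a < r) :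
    Integrable (fun e => Real.exp (a * e)) (expMeasure r) ∧
      ∫ e, Real.exp (a * e) ∂expMeasure r = r / (r - a) := by
  have hlt : ∀ᵐ x ∂(volume : Measure ℝ), exponentialPDF r x < ⊤ :=
    Filter.Eventually.of_forall fun x => ENNReal.ofReal_lt_top
  have heq : (fun x => (exponentialPDF r x).toReal • Real.exp (a * x))
      = (Set.Ici (0 : ℝ)).indicator fun x => r * Real.exp ((a - r) * x) := by
    ext x
    by_cases hx : 0 ≤ x
    · rw [Set.indicator_of_mem (Set.mem_Ici.2 hx), exponentialPDF_of_nonneg hx,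
        ENNReal.toReal_ofReal (by positivity), smul_eq_mul, mul_assoc, ← Real.exp_add]
      ring_nf
    · rw [Set.indicator_of_notMem (by simpa using hx), exponentialPDF_of_neg (not_le.1 hx)]
      simp
  constructor
  · rw [withDensity_exponentialPDF, integrable_withDensity_iff_integrable_smul'
      (measurable_exponentialPDF r) hlt, heq, integrable_indicator_iff measurableSet_Ici,
      integrableOn_Ici_iff_integrableOn_Ioi]
    exact (integrableOn_exp_mul_Ioi (by linarith) 0).const_mul r
  · rw [withDensity_exponentialPDF, integral_withDensity_eq_integral_toReal_smul
      (measurable_exponentialPDF r) hlt, heq, integral_indicator measurableSet_Ici,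
      integral_Ici_eq_integral_Ioi, integral_const_mul, integral_exp_mul_Ioi (by linarith)]
    have h1 : a - r ≠ 0 := by linarith
    have h2 : r - a ≠ 0 := by linarith
    rw [mul_zero, Real.exp_zero, ← neg_sub r a, neg_div_neg_eq]
    ring

lemma map_add_expMeasure (r u : ℝ) :
    (expMeasure r).map (fun e => u + e)
      = volume.withDensity fun y => exponentialPDF r (y - u) := by
  ext s hs
  have hm : Measurable fun e : ℝ => u + e := by fun_prop
  rw [Measure.map_apply hm hs, withDensity_exponentialPDF, withDensity_apply _ (hm hs),
    withDensity_apply _ hs, ← lintegral_indicator (hm hs), ← lintegral_indicator hs,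
    ← lintegral_add_left_eq_self (s.indicator _) u]
  refine lintegral_congr fun e => ?_
  by_cases he : u + e ∈ s
  · rw [Set.indicator_of_mem he, Set.indicator_of_mem (by exact he)]; simp
  · rw [Set.indicator_of_notMem he, Set.indicator_of_notMem (by exact he)]

/-- The shifts of an exponential distribution by a bounded amount have a common component. -/
lemma restrict_expMeasure_le_map_add {r u K : ℝ} (hr : 0 < r) (hu : 0 ≤ u) (huK : u ≤ K) :
    (expMeasure r).restrict (Set.Ici K) ≤ (expMeasure r).map fun e => u + e := by
  rw [map_add_expMeasure, withDensity_exponentialPDF, restrict_withDensity measurableSet_Ici,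
    ← withDensity_indicator measurableSet_Ici]
  refine withDensity_mono (Filter.Eventually.of_forall fun y => ?_)
  by_cases hy : K ≤ y
  swap
  · rw [Set.indicator_of_notMem (by simpa using hy)]
    exact zero_le
  rw [Set.indicator_of_mem (Set.mem_Ici.2 hy)]
  change exponentialPDF r y ≤ exponentialPDF r (y - u)
  rw [exponentialPDF_of_nonneg (by linarith), exponentialPDF_of_nonneg (by linarith)]
  -- For y ≥ K ≥ u ≥ 0 the shifted density is larger by the factor e^{ru} ≥ 1.
  refine ENNReal.ofReal_le_ofReal ?_
  gcongr
  linarith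

/-! ### The transition kernel, its drift and its small sets -/

namespace EHRelay

namespace Params

variable (θ : Params)

lemma nextLaw_apply (ν : Measure ℝ) [SFinite ν] {s : Set ℝ} (hs : MeasurableSet s) :
    θ.nextLaw ν s
      = ENNReal.ofReal θ.b1 * ∫⁻ x, expMeasure θ.lam1 {e | θ.step x True e ∈ s} ∂ν
        + ENNReal.ofReal (1 - θ.b1) * ∫⁻ x, expMeasure θ.lam1 {e | θ.step x False e ∈ s} ∂ν := by
  have hT := measurable_step θ True
  have hF := measurable_step θ False
  rw [nextLaw, Measure.add_apply, Measure.smul_apply, Measure.smul_apply, smul_eq_mul, smul_eq_mul,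
    Measure.map_apply hT hs, Measure.map_apply hF hs, Measure.prod_apply (hT hs),
    Measure.prod_apply (hF hs)]
  rfl

lemma measurable_expMeasure_step (p : Prop) {s : Set ℝ} (hs : MeasurableSet s) :
    Measurable fun x => expMeasure θ.lam1 {e | θ.step x p e ∈ s} :=
  measurable_measure_prodMk_left (measurable_step θ p hs)

lemma nextLaw_dirac_apply (x : ℝ) {s : Set ℝ} (hs : MeasurableSet s) :
    θ.nextLaw (Measure.dirac x) s
      = ENNReal.ofReal θ.b1 * expMeasure θ.lam1 {e | θ.step x True e ∈ s}
        + ENNReal.ofReal (1 - θ.b1) * expMeasure θ.lam1 {e | θ.step x False e ∈ s} := by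
  rw [nextLaw_apply θ _ hs, lintegral_dirac' _ (θ.measurable_expMeasure_step True hs),
    lintegral_dirac' _ (θ.measurable_expMeasure_step False hs)]

/-- The transition kernel of the stored energy, extended to negative levels by treating them as
zero. -/
noncomputable def bufferKernel : Kernel ℝ ℝ where
  -- Truncation makes drift and minorization hold at every real point, as `HarrisCondition` demands.
  toFun x := θ.nextLaw (Measure.dirac (max x 0))
  measurable' := by
    refine Measure.measurable_of_measurable_coe _ fun s hs => ?_
    simp only [nextLaw_dirac_apply θ _ hs]
    have hm : Measurable fun x : ℝ => max x 0 := by fun_prop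
    exact (((θ.measurable_expMeasure_step True hs).comp hm).const_mul _).add
      (((θ.measurable_expMeasure_step False hs).comp hm).const_mul _)

lemma bufferKernel_apply' (x : ℝ) : θ.bufferKernel x = θ.nextLaw (Measure.dirac (max x 0)) := rfl

lemma bind_bufferKernel {ν : Measure ℝ} [SFinite ν] (hν : ν (Set.Iio 0) = 0) :
    ν.bind θ.bufferKernel = θ.nextLaw ν := by
  have hae : ∀ᵐ x ∂ν, max x 0 = x := by
    have : ∀ᵐ x ∂ν, 0 ≤ x := by
      rw [ae_iff]
      simpa only [not_le] using! hν
    filter_upwards [this] with x hx using max_eq_left hx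
  ext s hs
  rw [Measure.bind_apply hs θ.bufferKernel.aemeasurable, nextLaw_apply θ ν hs,
    ← lintegral_const_mul _ (θ.measurable_expMeasure_step True hs),
    ← lintegral_const_mul _ (θ.measurable_expMeasure_step False hs),
    ← lintegral_add_left ((θ.measurable_expMeasure_step True hs).const_mul _)]
  refine lintegral_congr_ae ?_
  filter_upwards [hae] with x hx
  rw [bufferKernel_apply', hx, nextLaw_dirac_apply θ _ hs]

/-- The level left after a discharge is called for. -/
noncomputable def residual (x : ℝ) : ℝ := if θ.M1 ≤ x then x - θ.M1 else x

lemma step_true (x e : ℝ) : θ.step x True e = θ.residual x + e := by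
  unfold step residual
  simp only [true_and]
  split_ifs <;> rfl

lemma step_false (x e : ℝ) : θ.step x False e = x + e := by
  simp [step]

lemma measurable_residual : Measurable θ.residual :=
  Measurable.ite measurableSet_Ici (by fun_prop) (by fun_prop)

variable {θ}

lemma residual_nonneg {x : ℝ} (hx : 0 ≤ x) : 0 ≤ θ.residual x := by
  unfold residual; split_ifs <;> linarith

lemma residual_le (hM : 0 < θ.M1) (x : ℝ) : θ.residual x ≤ x := by
  unfold residual; split_ifs <;> linarith

variable (θ) in
lemma bufferKernel_apply (x : ℝ) : θ.bufferKernel x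
    = ENNReal.ofReal θ.b1 • (expMeasure θ.lam1).map (fun e => θ.residual (max x 0) + e)
      + ENNReal.ofReal (1 - θ.b1) • (expMeasure θ.lam1).map (fun e => max x 0 + e) := by
  ext s hs
  rw [bufferKernel_apply', nextLaw_dirac_apply θ _ hs]
  simp only [step_true, step_false]
  rw [Measure.add_apply, Measure.smul_apply, Measure.smul_apply,
    Measure.map_apply (by fun_prop) hs, Measure.map_apply (by fun_prop) hs]
  rfl

lemma ofReal_b1_add (hb0 : 0 ≤ θ.b1) (hb1 : θ.b1 ≤ 1) :
    ENNReal.ofReal θ.b1 + ENNReal.ofReal (1 - θ.b1) = 1 := by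
  rw [← ENNReal.ofReal_add hb0 (by linarith)]; simp

lemma isMarkovKernel_bufferKernel (hb0 : 0 ≤ θ.b1) (hb1 : θ.b1 ≤ 1) (hlam : 0 < θ.lam1) :
    IsMarkovKernel θ.bufferKernel := by
  have := isProbabilityMeasure_expMeasure hlam
  refine ⟨fun x => ⟨?_⟩⟩
  rw [bufferKernel_apply, Measure.add_apply, Measure.smul_apply, Measure.smul_apply,
    Measure.map_apply (by fun_prop) MeasurableSet.univ,
    Measure.map_apply (by fun_prop) MeasurableSet.univ]
  simpa using ofReal_b1_add hb0 hb1

lemma isProbabilityMeasure_nextLaw (hb0 : 0 ≤ θ.b1) (hb1 : θ.b1 ≤ 1) (hlam : 0 < θ.lam1)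
    (ν : Measure ℝ) [IsProbabilityMeasure ν] : IsProbabilityMeasure (θ.nextLaw ν) := by
  have := isProbabilityMeasure_expMeasure hlam
  refine ⟨?_⟩
  rw [nextLaw_apply θ ν MeasurableSet.univ]
  simpa using ofReal_b1_add hb0 hb1

lemma nextLaw_Iio_zero {ν : Measure ℝ} [SFinite ν] (hν : ν (Set.Iio 0) = 0) :
    θ.nextLaw ν (Set.Iio 0) = 0 := by
  have hae : ∀ᵐ x ∂ν, 0 ≤ x := by
    rw [ae_iff]
    simpa only [not_le] using! hν
  have key : ∀ u : ℝ, 0 ≤ u → expMeasure θ.lam1 {e | u + e ∈ Set.Iio 0} = 0 := fun u hu =>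
    measure_mono_null (fun e (he : u + e < 0) => by
      change e < 0
      linarith) (expMeasure_Iio_zero θ.lam1)
  rw [nextLaw_apply θ ν measurableSet_Iio]
  simp only [step_true, step_false]
  have h1 : ∫⁻ x, expMeasure θ.lam1 {e | θ.residual x + e ∈ Set.Iio 0} ∂ν = ∫⁻ _, 0 ∂ν :=
    lintegral_congr_ae (by filter_upwards [hae] with x hx using key _ (residual_nonneg hx))
  have h2 : ∫⁻ x, expMeasure θ.lam1 {e | x + e ∈ Set.Iio 0} ∂ν = ∫⁻ _, 0 ∂ν :=
    lintegral_congr_ae (by filter_upwards [hae] with x hx using key x hx)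
  rw [h1, h2]
  simp

/-- The exponential Lyapunov function. -/
noncomputable def lyapunov (a x : ℝ) : ℝ := Real.exp (a * max x 0)

/-- The harvest multiplies e^{au} by its moment generating function λ₁/(λ₁−a); the truncation is
invisible since u + e ≥ 0 almost surely. -/
lemma integral_lyapunov_map_add {a u : ℝ} (hlam : 0 < θ.lam1) (ha : a < θ.lam1) (hu : 0 ≤ u) :
    Integrable (lyapunov a) ((expMeasure θ.lam1).map fun e => u + e) ∧
      ∫ y, lyapunov a y ∂((expMeasure θ.lam1).map fun e => u + e)
        = θ.lam1 / (θ.lam1 - a) * Real.exp (a * u) := by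
  obtain ⟨hi, he⟩ := integral_exp_mul_expMeasure hlam ha
  have hm : AEMeasurable (fun e : ℝ => u + e) (expMeasure θ.lam1) := by fun_prop
  have hV : Measurable (lyapunov a) := by unfold lyapunov; fun_prop
  have hae : (fun e => lyapunov a (u + e)) =ᵐ[expMeasure θ.lam1]
      fun e => Real.exp (a * u) * Real.exp (a * e) := by
    filter_upwards [ae_nonneg_expMeasure θ.lam1] with e he
    rw [lyapunov, max_eq_left (by positivity), mul_add, Real.exp_add]
  constructor
  · rw [integrable_map_measure hV.aestronglyMeasurable hm]
    exact (hi.const_mul _).congr hae.symm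
  · rw [integral_map hm hV.aestronglyMeasurable, integral_congr_ae hae, integral_const_mul, he,
      mul_comm]

/-- The energy buffer satisfies Harris' condition. -/
lemma harrisCondition_bufferKernel (hM : 0 < θ.M1) (hlam : 0 < θ.lam1) (hb0 : 0 ≤ θ.b1)
    (hb1 : θ.b1 ≤ 1) (hψ : 1 < θ.psi1) :
    ∃ (V : ℝ → ℝ) (γ C : ℝ), HarrisCondition θ.bufferKernel V γ C := by
  have hQ := Q1_neg hM hψ
  have hE := exp_Q1_mul_M1 hM hψ
  have hpos := b1_mul_lam1_add_Q1_pos hM hψ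
  have hbl := b1_mul_lam1_pos hM hψ
  -- The drift factor λ₁(b₁e^{−aM} + 1 − b₁)/(λ₁ − a) equals 1 at a = 0 and, by the characteristic
  -- equation, at a = −Q₁; convexity suggests the midpoint.
  obtain ⟨a, ha⟩ : ∃ a, a = -θ.Q1 / 2 := ⟨_, rfl⟩
  have ha0 : 0 < a := by rw [ha]; linarith
  have hle : θ.b1 * θ.lam1 ≤ θ.lam1 := by nlinarith
  have hal : a < θ.lam1 := by rw [ha]; linarith
  have hd : 0 < θ.lam1 - a := by linarith
  set L := θ.lam1 / (θ.lam1 - a) with hL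
  have hL0 : 0 < L := by positivity
  set t := Real.exp (-(a * θ.M1)) with ht
  have ht0 : 0 < t := Real.exp_pos _
  have ht1 : t < 1 := Real.exp_lt_one_iff.2 (by have := mul_pos ha0 hM; linarith)
  have htt : θ.b1 * θ.lam1 * (t * t) = θ.b1 * θ.lam1 - 2 * a := by
    have : t * t = Real.exp (θ.Q1 * θ.M1) := by
      rw [ht, ← Real.exp_add, ha]; ring_nf
    rw [this, hE, ha]; ring
  have hfin := isMarkovKernel_bufferKernel hb0 hb1 hlam
  have hint : ∀ x, Integrable (lyapunov a) (θ.bufferKernel x) ∧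
      ∫ y, lyapunov a y ∂θ.bufferKernel x
        = L * (θ.b1 * Real.exp (a * θ.residual (max x 0)) + (1 - θ.b1) * lyapunov a x) := by
    intro x
    have h0 : 0 ≤ max x 0 := le_max_right _ _
    obtain ⟨i1, e1⟩ := integral_lyapunov_map_add hlam hal (residual_nonneg (θ := θ) h0)
    obtain ⟨i2, e2⟩ := integral_lyapunov_map_add (θ := θ) hlam hal h0
    have j1 := i1.smul_measure (c := ENNReal.ofReal θ.b1) ENNReal.ofReal_ne_top
    have j2 := i2.smul_measure (c := ENNReal.ofReal (1 - θ.b1)) ENNReal.ofReal_ne_top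
    rw [bufferKernel_apply]
    refine ⟨j1.add_measure j2, ?_⟩
    rw [integral_add_measure j1 j2, integral_smul_measure, integral_smul_measure, e1, e2,
      ENNReal.toReal_ofReal hb0, ENNReal.toReal_ofReal (by linarith), lyapunov]
    simp only [smul_eq_mul]
    ring
  refine ⟨lyapunov a, L * (θ.b1 * t + (1 - θ.b1)), L * Real.exp (a * θ.M1), ?_, ?_, ?_, ?_, ?_, ?_,
    ?_, ?_⟩
  · unfold lyapunov; fun_prop
  · exact fun x => (Real.exp_pos _).le
  · exact fun x => (hint x).1
  · have : 0 ≤ 1 - θ.b1 := by linarith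
    positivity
  -- The claim amounts to a < b₁λ₁(1 − t), and `htt` gives b₁λ₁(1 − t)² = 2(b₁λ₁(1 − t) − a).
  · rw [hL, div_mul_eq_mul_div, div_lt_one hd]
    have : 0 < θ.b1 * θ.lam1 * ((1 - t) * (1 - t)) := by
      have : 0 < 1 - t := by linarith
      positivity
    nlinarith
  · positivity
  · intro x
    rw [(hint x).2]
    have hV : 0 < lyapunov a x := Real.exp_pos _
    have h1b : 0 ≤ 1 - θ.b1 := by linarith
    -- Above M a discharge multiplies the Lyapunov function by t; below M the function is at most
    -- e^{aM} and goes into the constant.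
    by_cases hx : θ.M1 ≤ max x 0
    · have : Real.exp (a * θ.residual (max x 0)) = t * lyapunov a x := by
        rw [residual, if_pos hx, ht, lyapunov, ← Real.exp_add]; ring_nf
      rw [this]
      have : 0 ≤ L * Real.exp (a * θ.M1) := by positivity
      nlinarith
    · have hVM : lyapunov a x ≤ Real.exp (a * θ.M1) := by
        rw [lyapunov]; gcongr; linarith
      rw [residual, if_neg hx, ← lyapunov]
      have h1 : L * (θ.b1 * lyapunov a x + (1 - θ.b1) * lyapunov a x)
          ≤ L * Real.exp (a * θ.M1) := by
        gcongr; linarith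
      have : 0 ≤ L * (θ.b1 * t + (1 - θ.b1)) * lyapunov a x := by positivity
      linarith
  · intro R
    -- From 1 + s ≤ e^s, V x ≤ R bounds the level by |R|/a. Both branches of the kernel then
    -- dominate this one measure, hence so does their mixture.
    refine ⟨(expMeasure θ.lam1).restrict (Set.Ici (|R| / a)), ?_, fun x hx => ?_⟩
    · rw [measureReal_restrict_apply MeasurableSet.univ, Set.univ_inter,
        expMeasure_real_Ici hlam (by positivity)]
      exact Real.exp_pos _
    · have h0 : 0 ≤ max x 0 := le_max_right _ _
      have hK : max x 0 ≤ |R| / a := by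
        rw [le_div_iff₀ ha0]
        have h1 := Real.add_one_le_exp (a * max x 0)
        rw [lyapunov] at hx
        linarith [le_abs_self R]
      have m1 := restrict_expMeasure_le_map_add hlam (residual_nonneg (θ := θ) h0)
        ((residual_le hM _).trans hK)
      have m2 := restrict_expMeasure_le_map_add hlam h0 hK
      rw [bufferKernel_apply]
      calc (expMeasure θ.lam1).restrict (Set.Ici (|R| / a))
          = ENNReal.ofReal θ.b1 • (expMeasure θ.lam1).restrict (Set.Ici (|R| / a))
            + ENNReal.ofReal (1 - θ.b1) • (expMeasure θ.lam1).restrict (Set.Ici (|R| / a)) := by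
            rw [← add_smul, ofReal_b1_add hb0 hb1, one_smul]
        _ ≤ _ := by gcongr

end Params

end EHRelay

/-! ### Stationarity, convergence and uniqueness -/

namespace EHRelay

namespace Params

variable {θ : Params}

/-- The density, under the limiting law, of the energy level after a possible discharge and before
the harvest. -/
noncomputable def dischargedDensity (θ : Params) (x : ℝ) : ℝ :=
  θ.b1 * ((Set.Iio θ.M1).indicator θ.g1 x + (Set.Ici 0).indicator (fun x => θ.g1 (x + θ.M1)) x)
    + (1 - θ.b1) * θ.g1 x

lemma measurable_dischargedDensity : Measurable θ.dischargedDensity := by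
  have hg := measurable_g1 (θ := θ)
  have h1 := hg.indicator (measurableSet_Iio (a := θ.M1))
  have h2 : Measurable ((Set.Ici (0 : ℝ)).indicator fun x => θ.g1 (x + θ.M1)) :=
    (hg.comp (measurable_add_const θ.M1)).indicator measurableSet_Ici
  exact ((h1.add h2).const_mul _).add (hg.const_mul _)

/-- The update of laws as a convolution. -/
lemma nextLaw_eq_conv (ν : Measure ℝ) [SFinite ν] :
    θ.nextLaw ν = (ENNReal.ofReal θ.b1 • ν.map θ.residual + ENNReal.ofReal (1 - θ.b1) • ν)
      ∗ expMeasure θ.lam1 := by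
  ext s hs
  have hm : Measurable fun q : ℝ × ℝ => q.1 + q.2 := by fun_prop
  have hms : Measurable fun x => expMeasure θ.lam1 {e | x + e ∈ s} :=
    measurable_measure_prodMk_left (hm hs)
  rw [nextLaw_apply θ ν hs, Measure.conv, Measure.map_apply hm hs, Measure.prod_apply (hm hs)]
  simp only [step_true, step_false]
  change _ = ∫⁻ x, expMeasure θ.lam1 {e | x + e ∈ s} ∂_
  rw [lintegral_add_measure, lintegral_smul_measure, lintegral_smul_measure,
    lintegral_map hms θ.measurable_residual]
  rfl

section Stationary

variable (hM : 0 < θ.M1) (hψ : 1 < θ.psi1)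

lemma map_residual_limitLaw : θ.limitLaw.map θ.residual
    = volume.withDensity fun x => (Set.Iio θ.M1).indicator (fun x => ENNReal.ofReal (θ.g1 x)) x
      + (Set.Ici 0).indicator (fun x => ENNReal.ofReal (θ.g1 (x + θ.M1))) x := by
  have hG : Measurable fun x => ENNReal.ofReal (θ.g1 x) := measurable_g1.ennreal_ofReal
  have hG' : Measurable fun x => ENNReal.ofReal (θ.g1 (x + θ.M1)) :=
    hG.comp (measurable_add_const θ.M1)
  ext s hs
  have hres := θ.measurable_residual hs
  rw [Measure.map_apply θ.measurable_residual hs, limitLaw, withDensity_apply _ hres,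
    withDensity_apply _ hs, lintegral_add_left (hG.indicator measurableSet_Iio),
    ← lintegral_indicator hres, ← lintegral_indicator hs, ← lintegral_indicator hs]
  -- Translating the second term by M back to the level before discharge allows a pointwise
  -- comparison of integrands.
  have hshift : ∫⁻ x, s.indicator
        (fun x => (Set.Ici 0).indicator (fun x => ENNReal.ofReal (θ.g1 (x + θ.M1))) x) x
      = ∫⁻ x, s.indicator
        (fun x => (Set.Ici 0).indicator (fun x => ENNReal.ofReal (θ.g1 (x + θ.M1))) x)
          (x - θ.M1) := (lintegral_sub_right_eq_self _ θ.M1).symm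
  rw [hshift, ← lintegral_add_left ((hG.indicator measurableSet_Iio).indicator hs)]
  refine lintegral_congr fun x => ?_
  by_cases hx : θ.M1 ≤ x
  · have h1 : x ∉ Set.Iio θ.M1 := by simpa using hx
    have h2 : x - θ.M1 ∈ Set.Ici (0 : ℝ) := by simpa using hx
    have h3 : x ∈ θ.residual ⁻¹' s ↔ x - θ.M1 ∈ s := by
      rw [Set.mem_preimage, residual, if_pos hx]
    by_cases hs' : x - θ.M1 ∈ s
    · rw [Set.indicator_of_mem (h3.2 hs'), Set.indicator_of_mem hs', Set.indicator_of_mem h2]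
      by_cases hs'' : x ∈ s <;> simp [hs'', hx]
    · rw [Set.indicator_of_notMem (fun h => hs' (h3.1 h)), Set.indicator_of_notMem hs']
      by_cases hs'' : x ∈ s <;> simp [hs'', hx]
  · have h1 : x ∈ Set.Iio θ.M1 := by simpa using hx
    have h2 : x - θ.M1 ∉ Set.Ici (0 : ℝ) := by simpa using hx
    have h3 : x ∈ θ.residual ⁻¹' s ↔ x ∈ s := by
      rw [Set.mem_preimage, residual, if_neg hx]
    have h4 : s.indicator (fun x => (Set.Ici (0 : ℝ)).indicator
        (fun x => ENNReal.ofReal (θ.g1 (x + θ.M1))) x) (x - θ.M1) = 0 := by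
      by_cases hs' : x - θ.M1 ∈ s
      · rw [Set.indicator_of_mem hs', Set.indicator_of_notMem h2]
      · rw [Set.indicator_of_notMem hs']
    rw [h4, add_zero]
    by_cases hs' : x ∈ s
    · rw [Set.indicator_of_mem (h3.2 hs'), Set.indicator_of_mem hs', Set.indicator_of_mem h1]
    · rw [Set.indicator_of_notMem (fun h => hs' (h3.1 h)), Set.indicator_of_notMem hs']

include hM

lemma dischargedDensity_of_neg {x : ℝ} (hx : x < 0) : θ.dischargedDensity x = 0 := by
  rw [dischargedDensity, Set.indicator_of_mem (Set.mem_Iio.2 (hx.trans hM)),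
    Set.indicator_of_notMem (by simpa using hx), g1_of_neg hx]
  simp

include hψ

lemma dischargedDensity_nonneg (hb0 : 0 ≤ θ.b1) (hb1 : θ.b1 ≤ 1) (x : ℝ) :
    0 ≤ θ.dischargedDensity x := by
  have hg := g1_nonneg hM hψ
  have h1 : 0 ≤ (Set.Iio θ.M1).indicator θ.g1 x := Set.indicator_nonneg (fun x _ => hg x) x
  have h2 : 0 ≤ (Set.Ici (0 : ℝ)).indicator (fun x => θ.g1 (x + θ.M1)) x :=
    Set.indicator_nonneg (fun x _ => hg _) x
  have h3 := hg x
  have : 0 ≤ 1 - θ.b1 := by linarith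
  rw [dischargedDensity]
  positivity

lemma integrable_dischargedDensity : Integrable θ.dischargedDensity := by
  have hi := (hasIntegral_g1 hM hψ).1
  exact (((hi.indicator measurableSet_Iio).add
    ((hi.comp_add_right θ.M1).indicator measurableSet_Ici)).const_mul _).add (hi.const_mul _)

lemma discharged_limitLaw (hb0 : 0 ≤ θ.b1) (hb1 : θ.b1 ≤ 1) :
    ENNReal.ofReal θ.b1 • θ.limitLaw.map θ.residual + ENNReal.ofReal (1 - θ.b1) • θ.limitLaw
      = volume.withDensity fun x => ENNReal.ofReal (θ.dischargedDensity x) := by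
  have hg := g1_nonneg hM hψ
  have hG : Measurable fun x => ENNReal.ofReal (θ.g1 x) := measurable_g1.ennreal_ofReal
  have hG' : Measurable fun x => ENNReal.ofReal (θ.g1 (x + θ.M1)) :=
    hG.comp (measurable_add_const θ.M1)
  have hH : Measurable fun x => (Set.Iio θ.M1).indicator (fun x => ENNReal.ofReal (θ.g1 x)) x
      + (Set.Ici 0).indicator (fun x => ENNReal.ofReal (θ.g1 (x + θ.M1))) x :=
    (hG.indicator measurableSet_Iio).add (hG'.indicator measurableSet_Ici)
  rw [map_residual_limitLaw, limitLaw, ← withDensity_smul _ hH, ← withDensity_smul _ hG,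
    ← withDensity_add_left (hH.const_smul _)]
  congr 1
  ext x
  have h1 : (Set.Iio θ.M1).indicator (fun x => ENNReal.ofReal (θ.g1 x)) x
      = ENNReal.ofReal ((Set.Iio θ.M1).indicator θ.g1 x) := by
    by_cases hx : x ∈ Set.Iio θ.M1 <;> simp [Set.indicator, hx]
  have h2 : (Set.Ici 0).indicator (fun x => ENNReal.ofReal (θ.g1 (x + θ.M1))) x
      = ENNReal.ofReal ((Set.Ici 0).indicator (fun x => θ.g1 (x + θ.M1)) x) := by
    by_cases hx : x ∈ Set.Ici (0 : ℝ) <;> simp [Set.indicator, hx]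
  have p1 : 0 ≤ (Set.Iio θ.M1).indicator θ.g1 x := Set.indicator_nonneg (fun x _ => hg x) x
  have p2 : 0 ≤ (Set.Ici (0 : ℝ)).indicator (fun x => θ.g1 (x + θ.M1)) x :=
    Set.indicator_nonneg (fun x _ => hg _) x
  have p3 : 0 ≤ 1 - θ.b1 := by linarith
  simp only [Pi.add_apply, Pi.smul_apply, smul_eq_mul, dischargedDensity]
  rw [h1, h2, ← ENNReal.ofReal_add p1 p2, ← ENNReal.ofReal_mul hb0, ← ENNReal.ofReal_mul p3,
    ← ENNReal.ofReal_add (by positivity) (mul_nonneg p3 (hg x))]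

/-- The two formulas agree at M exactly by the characteristic equation. Continuity lets the
fundamental theorem of calculus pass the kink at M. -/
lemma continuousOn_g1 : ContinuousOn θ.g1 (Set.Ici 0) := by
  have hbl := b1_mul_lam1_add_Q1_pos hM hψ
  have hE := exp_Q1_mul_M1 hM hψ
  have hc : Continuous fun x => if θ.M1 ≤ x
      then 1 / θ.M1 * (-θ.Q1 * Real.exp (θ.Q1 * x) / (θ.b1 * θ.lam1 + θ.Q1))
      else 1 / θ.M1 * (1 - Real.exp (θ.Q1 * x)) := by
    refine Continuous.if_le (by fun_prop) (by fun_prop) continuous_const continuous_id ?_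
    rintro x rfl
    congr 1
    rw [div_eq_iff hbl.ne']
    linear_combination hE
  refine hc.continuousOn.congr fun x hx => ?_
  dsimp only
  by_cases h : θ.M1 ≤ x
  · rw [if_pos h, g1_of_le hM h]
  · rw [if_neg h, g1_of_mem_Ico ⟨hx, not_le.1 h⟩]

/-- The differential equation solved by the density `g₁`. -/
lemma hasDerivAt_exp_mul_g1 {x : ℝ} (hx0 : 0 < x) (hxM : x ≠ θ.M1) :
    HasDerivAt (fun u => Real.exp (θ.lam1 * u) * θ.g1 u)
      (θ.lam1 * Real.exp (θ.lam1 * x) * θ.dischargedDensity x) x := by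
  have hbl := b1_mul_lam1_add_Q1_pos hM hψ
  have hE := exp_Q1_mul_M1 hM hψ
  have hexp : ∀ c : ℝ, HasDerivAt (fun u => Real.exp (c * u)) (Real.exp (c * x) * c) x := fun c => by
    simpa using ((hasDerivAt_id x).const_mul c).exp
  have hsplit : Real.exp (θ.Q1 * (x + θ.M1)) = Real.exp (θ.Q1 * x) * Real.exp (θ.Q1 * θ.M1) := by
    rw [← Real.exp_add]; ring_nf
  have hgM : θ.g1 (x + θ.M1)
      = 1 / θ.M1 * (-θ.Q1 * (Real.exp (θ.Q1 * x) * Real.exp (θ.Q1 * θ.M1))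
        / (θ.b1 * θ.lam1 + θ.Q1)) := by
    rw [g1_of_le hM (by linarith), hsplit]
  -- The characteristic equation absorbs the factor e^{Q₁M} of the delayed term, so the delay
  -- equation becomes an identity in e^{Q₁x}.
  have hkey : θ.lam1 * θ.b1 * θ.g1 (x + θ.M1) = 1 / θ.M1 * (-θ.Q1 * Real.exp (θ.Q1 * x)) := by
    calc θ.lam1 * θ.b1 * θ.g1 (x + θ.M1)
        = 1 / θ.M1 * (-θ.Q1 * Real.exp (θ.Q1 * x))
          * (θ.b1 * θ.lam1 * Real.exp (θ.Q1 * θ.M1) / (θ.b1 * θ.lam1 + θ.Q1)) := by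
          rw [hgM]; ring
      _ = 1 / θ.M1 * (-θ.Q1 * Real.exp (θ.Q1 * x)) := by rw [hE, div_self hbl.ne', mul_one]
  rcases lt_or_gt_of_ne hxM with h | h
  · have hD : θ.dischargedDensity x = θ.g1 x + θ.b1 * θ.g1 (x + θ.M1) := by
      rw [dischargedDensity, Set.indicator_of_mem (Set.mem_Iio.2 h),
        Set.indicator_of_mem (Set.mem_Ici.2 hx0.le)]
      ring
    have hev : θ.g1 =ᶠ[nhds x] fun u => 1 / θ.M1 * (1 - Real.exp (θ.Q1 * u)) := by
      filter_upwards [Ioo_mem_nhds hx0 h] with u hu using g1_of_mem_Ico ⟨hu.1.le, hu.2⟩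
    have hd : HasDerivAt θ.g1 (1 / θ.M1 * (-(Real.exp (θ.Q1 * x) * θ.Q1))) x :=
      (((hexp θ.Q1).const_sub 1).const_mul (1 / θ.M1)).congr_of_eventuallyEq hev
    refine ((hexp θ.lam1).mul hd).congr_deriv ?_
    rw [hD]
    linear_combination -Real.exp (θ.lam1 * x) * hkey
  · have hD : θ.dischargedDensity x = (1 - θ.b1) * θ.g1 x + θ.b1 * θ.g1 (x + θ.M1) := by
      rw [dischargedDensity, Set.indicator_of_notMem (by simpa using h.le),
        Set.indicator_of_mem (Set.mem_Ici.2 hx0.le)]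
      ring
    have hev : θ.g1 =ᶠ[nhds x] fun u => 1 / θ.M1 * (-θ.Q1 / (θ.b1 * θ.lam1 + θ.Q1))
        * Real.exp (θ.Q1 * u) := by
      filter_upwards [Ioi_mem_nhds h] with u hu
      rw [g1_of_le hM (le_of_lt hu)]; ring
    have hd : HasDerivAt θ.g1 (1 / θ.M1 * (-θ.Q1 / (θ.b1 * θ.lam1 + θ.Q1))
        * (Real.exp (θ.Q1 * x) * θ.Q1)) x :=
      ((hexp θ.Q1).const_mul _).congr_of_eventuallyEq hev
    refine ((hexp θ.lam1).mul hd).congr_deriv ?_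
    have hgx := g1_of_le hM h.le
    have hdiff : 1 / θ.M1 * (-θ.Q1 / (θ.b1 * θ.lam1 + θ.Q1)) * (Real.exp (θ.Q1 * x) * θ.Q1)
        = θ.lam1 * θ.b1 * (θ.g1 (x + θ.M1) - θ.g1 x) := by
      rw [mul_sub, hkey, hgx]
      have hM' := hM.ne'
      have hbl' := hbl.ne'
      field_simp
      ring
    rw [hD, hdiff]
    ring

/-- This is the convolution identity for stationarity: the derivative of e^{λ₁u}g₁(u) is integrated
over [0, y] and multiplied by e^{−λ₁y}. The boundary term vanishes because g₁(0) = 0. -/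
lemma integral_dischargedDensity_mul_exp {y : ℝ} (hy : 0 ≤ y) :
    IntervalIntegrable (fun u => θ.dischargedDensity u * (θ.lam1 * Real.exp (-(θ.lam1 * (-u + y)))))
        volume 0 y ∧
      ∫ u in (0 : ℝ)..y, θ.dischargedDensity u * (θ.lam1 * Real.exp (-(θ.lam1 * (-u + y))))
        = θ.g1 y := by
  have hint : IntervalIntegrable
      (fun u => θ.lam1 * Real.exp (θ.lam1 * u) * θ.dischargedDensity u) volume 0 y :=
    ((integrable_dischargedDensity hM hψ).intervalIntegrable).continuousOn_mul (by fun_prop)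
  have hftc := integral_eq_of_hasDerivAt_off_countable_of_le
    (fun u => Real.exp (θ.lam1 * u) * θ.g1 u)
    (fun u => θ.lam1 * Real.exp (θ.lam1 * u) * θ.dischargedDensity u) hy
    (Set.countable_singleton θ.M1)
    (ContinuousOn.mul (by fun_prop) ((continuousOn_g1 hM hψ).mono Set.Icc_subset_Ici_self))
    (fun x hx => hasDerivAt_exp_mul_g1 hM hψ hx.1.1 hx.2) hint
  have hg0 : θ.g1 0 = 0 := by rw [g1_of_mem_Ico ⟨le_rfl, hM⟩]; simp
  have heq : (fun u => θ.dischargedDensity u * (θ.lam1 * Real.exp (-(θ.lam1 * (-u + y)))))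
      = fun u => Real.exp (-(θ.lam1 * y))
        * (θ.lam1 * Real.exp (θ.lam1 * u) * θ.dischargedDensity u) := by
    ext u
    have : Real.exp (-(θ.lam1 * (-u + y))) = Real.exp (-(θ.lam1 * y)) * Real.exp (θ.lam1 * u) := by
      rw [← Real.exp_add]; ring_nf
    rw [this]; ring
  rw [heq]
  refine ⟨hint.const_mul _, ?_⟩
  rw [intervalIntegral.integral_const_mul, hftc, hg0, mul_zero, sub_zero, ← mul_assoc,
    ← Real.exp_add]
  simp

/-- The law with density `g₁` is stationary. -/
lemma isStationary_limitLaw (hlam : 0 < θ.lam1) (hb0 : 0 ≤ θ.b1) (hb1 : θ.b1 ≤ 1) :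
    θ.IsStationary θ.limitLaw := by
  have := isProbabilityMeasure_limitLaw hM hψ
  refine ⟨this, limitLaw_Iio_zero, ?_⟩
  have hD := dischargedDensity_nonneg hM hψ hb0 hb1
  rw [nextLaw_eq_conv, discharged_limitLaw hM hψ hb0 hb1, withDensity_exponentialPDF,
    conv_withDensity_eq_lconvolution measurable_dischargedDensity.ennreal_ofReal
      (measurable_exponentialPDF _), limitLaw]
  congr 1
  ext y
  rw [lconvolution_def]
  -- Both factors vanish on the negative axis, which confines the convolution to [0, y].
  have hint : (fun u => ENNReal.ofReal (θ.dischargedDensity u) * exponentialPDF θ.lam1 (-u + y))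
      = (Set.Icc 0 y).indicator fun u => ENNReal.ofReal
        (θ.dischargedDensity u * (θ.lam1 * Real.exp (-(θ.lam1 * (-u + y))))) := by
    ext u
    by_cases hu : u ∈ Set.Icc 0 y
    · rw [Set.indicator_of_mem hu, exponentialPDF_of_nonneg (by linarith [hu.2]),
        ENNReal.ofReal_mul (hD u)]
    · rw [Set.indicator_of_notMem hu]
      by_cases hu0 : u < 0
      · rw [dischargedDensity_of_neg hM hu0]; simp
      · have : -u + y < 0 := by
          by_contra h
          exact hu ⟨not_lt.1 hu0, by linarith⟩
        rw [exponentialPDF_of_neg this, mul_zero]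
  rw [hint, lintegral_indicator measurableSet_Icc]
  rcases lt_or_ge y 0 with hy | hy
  · rw [Set.Icc_eq_empty (not_le.2 hy), g1_of_neg hy]
    simp
  · obtain ⟨hi, he⟩ := integral_dischargedDensity_mul_exp hM hψ hy
    rw [setLIntegral_congr Ioc_ae_eq_Icc.symm, ← ofReal_integral_eq_lintegral_ofReal
      ((intervalIntegrable_iff_integrableOn_Ioc_of_le hy).1 hi)
      (Filter.Eventually.of_forall fun u => mul_nonneg (hD u) (by positivity)),
      ← intervalIntegral.integral_of_le hy, he]

/-- The iterated energy update converges to the limiting law in total variation. -/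
lemma tendstoTV_of_nextLaw (hlam : 0 < θ.lam1) (hb0 : 0 ≤ θ.b1) (hb1 : θ.b1 ≤ 1)
    {μ : ℕ → Measure ℝ} [IsProbabilityMeasure (μ 0)] (h0 : μ 0 (Set.Iio 0) = 0)
    (hμ : ∀ n, μ (n + 1) = θ.nextLaw (μ n)) : TendstoTV μ θ.limitLaw := by
  have := isMarkovKernel_bufferKernel hb0 hb1 hlam
  obtain ⟨V, γ, C, H⟩ := harrisCondition_bufferKernel hM hlam hb0 hb1 hψ
  have hπ := isStationary_limitLaw hM hψ hlam hb0 hb1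
  have := hπ.1
  have hn : ∀ n, IsProbabilityMeasure (μ n) ∧ μ n (Set.Iio 0) = 0 := by
    intro n
    induction n with
    | zero => exact ⟨inferInstance, h0⟩
    | succ n ih =>
      have := ih.1
      rw [hμ n]
      exact ⟨isProbabilityMeasure_nextLaw hb0 hb1 hlam _, nextLaw_Iio_zero ih.2⟩
  intro ε hε
  refine H.tendsto_totalVariation (ν := fun _ => θ.limitLaw) (fun n => ?_) (fun n => ?_) hε
  · have := (hn n).1
    rw [bind_bufferKernel θ (hn n).2, hμ n]
  · rw [bind_bufferKernel θ hπ.2.1, hπ.2.2]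

/-- Started from a stationary law the sequence of laws is constant, so its convergence in total
variation forces equality. -/
lemma IsStationary.eq_limitLaw (hlam : 0 < θ.lam1) (hb0 : 0 ≤ θ.b1) (hb1 : θ.b1 ≤ 1)
    {ν : Measure ℝ} (hν : θ.IsStationary ν) : ν = θ.limitLaw := by
  have := hν.1
  have := isProbabilityMeasure_limitLaw hM hψ
  have hTV := tendstoTV_of_nextLaw hM hψ hlam hb0 hb1 (μ := fun _ => ν) hν.2.1
    (fun _ => hν.2.2.symm)
  ext A hA
  rw [← measureReal_eq_measureReal_iff, ← sub_eq_zero, ← abs_nonpos_iff]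
  refine le_of_forall_pos_le_add fun ε hε => ?_
  obtain ⟨n, hn⟩ := hTV ε hε
  rw [zero_add]
  exact hn n le_rfl A hA

end Stationary

end Params

lemma TendstoTV.tendsto {μ : ℕ → Measure ℝ} {π : Measure ℝ} (h : TendstoTV μ π) {A : Set ℝ}
    (hA : MeasurableSet A) : Filter.Tendsto (fun i => (μ i).real A) Filter.atTop
      (nhds (π.real A)) := by
  rw [Metric.tendsto_atTop]
  intro ε hε
  obtain ⟨n, hn⟩ := h (ε / 2) (half_pos hε)
  exact ⟨n, fun i hi => (hn i hi A hA).trans_lt (half_lt_self hε)⟩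

end EHRelay
theorem theorem3 (θ : EHRelay.Params)
    (hM1 : 0 < θ.M1) (hlam1 : 0 < θ.lam1) (hR0 : 0 ≤ θ.R0)
    (hWSR2 : 0 < θ.WSR2) (hWR1R2 : 0 < θ.WR1R2)
    {Ω : Type*} [MeasurableSpace Ω] (P : MeasureTheory.Measure Ω)
    [MeasureTheory.IsProbabilityMeasure P]
    (N : EHRelay.Network Ω) (hN : N.IsModel θ P) (hψ : 1 < θ.psi1) :
    -- in every slot, a transmission by R1 is called for with probability `b₁`
    (∀ i, P.real (N.called θ i) = θ.b1)
    -- the exponent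
    ∧ θ.Q1 < 0
    ∧ θ.b1 * θ.lam1 * Real.exp (θ.Q1 * θ.M1) = θ.b1 * θ.lam1 + θ.Q1
    -- `g₁` is the density of the unique stationary distribution
    ∧ (∀ x, 0 ≤ θ.g1 x)
    ∧ MeasureTheory.Integrable θ.g1
    ∧ (∫ x, θ.g1 x) = 1
    ∧ θ.IsStationary θ.limitLaw
    ∧ (∀ ν : MeasureTheory.Measure ℝ, θ.IsStationary ν → ν = θ.limitLaw)
    ∧ (P.map (N.B1 0) = θ.limitLaw → ∀ i, P.map (N.B1 i) = θ.limitLaw)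
    -- `g₁` is the limiting density of the process
    ∧ EHRelay.TendstoTV (fun i => P.map (N.B1 i)) θ.limitLaw
    -- the probability of sufficient energy
    ∧ θ.limitLaw.real (Set.Ici θ.M1) = 1 / (θ.b1 * θ.lam1 * θ.M1)
    ∧ Filter.Tendsto (fun i => P.real {ω | θ.M1 ≤ N.B1 i ω}) Filter.atTop
        (nhds (1 / (θ.b1 * θ.lam1 * θ.M1))) := by

  have hcalled := fun i => hN.measureReal_called i hR0 hWSR2 hWR1R2
  -- The bounds 0 ≤ b₁ ≤ 1 are not assumed; they hold because b₁ is the probability of an event.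
  have hb0 : 0 ≤ θ.b1 := hcalled 0 ▸ MeasureTheory.measureReal_nonneg
  have hb1 : θ.b1 ≤ 1 := hcalled 0 ▸ MeasureTheory.measureReal_le_one
  have hlaw := fun i => hN.map_B1_succ i hR0 hWSR2 hWR1R2 hlam1
  have hB := hN.measurable_B1
  have hstat := EHRelay.Params.isStationary_limitLaw hM1 hψ hlam1 hb0 hb1
  have hprob : MeasureTheory.IsProbabilityMeasure (P.map (N.B1 0)) :=
    MeasureTheory.Measure.isProbabilityMeasure_map (hB 0).aemeasurable
  have hneg : P.map (N.B1 0) (Set.Iio 0) = 0 := by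
    rw [MeasureTheory.Measure.map_apply (hB 0) measurableSet_Iio]
    have h := hN.nonneg_B1
    rw [MeasureTheory.ae_iff] at h
    simpa only [not_le] using! h
  have hTV := EHRelay.Params.tendstoTV_of_nextLaw hM1 hψ hlam1 hb0 hb1
    (μ := fun i => P.map (N.B1 i)) hneg hlaw
  have hIci := EHRelay.Params.limitLaw_real_Ici hM1 hψ
  refine ⟨hcalled, EHRelay.Params.Q1_neg hM1 hψ, EHRelay.Params.exp_Q1_mul_M1 hM1 hψ,
    EHRelay.Params.g1_nonneg hM1 hψ, (EHRelay.Params.hasIntegral_g1 hM1 hψ).1,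
    (EHRelay.Params.hasIntegral_g1 hM1 hψ).2, hstat,
    fun ν hν => EHRelay.Params.IsStationary.eq_limitLaw hM1 hψ hlam1 hb0 hb1 hν,
    fun h i => ?_, hTV, hIci, ?_⟩
  · induction i with
    | zero => exact h
    | succ i ih => rw [hlaw i, ih, hstat.2.2]
  · rw [← hIci]
    refine (hTV.tendsto measurableSet_Ici).congr fun i => ?_
    rw [MeasureTheory.map_measureReal_apply (hB i) measurableSet_Ici]
    rfl
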